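/- Let $m\ge 1$, $l=2m+1$, and let $q\in\mathbb C$ be a primitive $l$-th root of unity. Let $U_q(sl_2)$ be the associative unital $\mathbb C$-algebra with generators $E,F,K^{\pm1}$ and relations $$KEK^{-1}=q^2E,\quad KFK^{-1}=q^{-2}F,\quad EF-FE=K-K^{-1},\quad K^l=1,\quad E^l=F^l=0 .$$ Put $[n]=\frac{q^n-q^{-n}}{q-q^{-1}}$, $[n]!=[n][n-1]\cdots[1]$ and $\gamma_q=\frac1{\sqrt l}\sum_{j=0}^{l-1}q^{mj^2}$. The ribbon element of $U_q(sl_2)$ is $$v_o=K\,u_K\,u_o,\qquad u_K=\frac{\gamma_q^{-1}}{\sqrt l}\sum_{i\in\mathbb Z/l}q^{mi^2}K^i,\qquad u_o=\sum_{n=0}^{l-1}\frac{q^{n(n+3)/2}}{[n]!}K^nF^nE^n .$$ Let $X=EF+\frac{qK^{-1}+q^{-1}K}{q-q^{-1}}$ be the Casimir element, let $b(j)=\frac{q^{2j+1}+q^{-(2j+1)}}{q-q^{-1}}$, and let $\phi_j$ be the polynomial $\phi_j(x)=\prod_{0\le s\le l-1,\ b(s)\ne b(j)}(x-b(s))$.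 Let $\pi_s(K)=\frac1l\sum_{i\in\mathbb Z/l}q^{2is}K^i$, and define $$P_j=\frac{\phi_j(X)}{\phi_j(b(j))}-\frac{\phi_j'(b(j))}{\phi_j(b(j))^2}(X-b(j))\phi_j(X)\quad(0\le j\le m),\qquad N_j=\frac{(X-b(j))\phi_j(X)}{\phi_j(b(j))}\quad(0\le j\le m-1),$$ $$T_j=\sum_{s=j+1}^{l-1-j}\pi_s(K),\qquad N_j^+=T_jN_j,\qquad N_j^-=(1-T_j)N_j\qquad(0\le j\le m-1).$$ Then $v_o$ is central in $U_q(sl_2)$, and with $d_j^+=2j+1$ and $d_j^-=l-(2j+1)$, $$v_o=q^mP_m+\sum_{j=0}^{m-1}q^{2j(j+1)}\Bigl(P_j+\frac{d_j^+}{[d_j^+]}N_j^++\frac{d_j^-}{[d_j^-]}N_j^-\Bigr).$$ This is the Jordan decomposition of $v_o$: the part $q^mP_m+\sum_{j<m}q^{2j(j+1)}P_j$ and the part $\sum_{j<m}q^{2j(j+1)}\bigl(\frac{d_j^+}{[d_j^+]}N_j^++\frac{d_j^-}{[d_j^-]}N_j^-\bigr)$ are both central, multiplication by the first is a semisimple endomorphism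 of $U_q(sl_2)$, and the second is nilpotent. -/

import Mathlib

open Polynomial

namespace SmallQuantum

noncomputable section

/-- The generators `E`, `F`, `K`, `K⁻¹`. -/
inductive Gen : Type
  | E
  | F
  | K
  | Kinv

/-- The defining relations of `U_q(sl₂)` at a primitive `l`-th root of unity `q`. -/
inductive Rel (l : ℕ) (q : ℂ) : FreeAlgebra ℂ Gen → FreeAlgebra ℂ Gen → Prop
  | K_mul_Kinv : Rel l q (FreeAlgebra.ι ℂ Gen.K * FreeAlgebra.ι ℂ Gen.Kinv) 1
  | Kinv_mul_K : Rel l q (FreeAlgebra.ι ℂ Gen.Kinv * FreeAlgebra.ι ℂ Gen.K) 1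
  | K_E : Rel l q
      (FreeAlgebra.ι ℂ Gen.K * FreeAlgebra.ι ℂ Gen.E * FreeAlgebra.ι ℂ Gen.Kinv)
      (q ^ 2 • FreeAlgebra.ι ℂ Gen.E)
  | K_F : Rel l q
      (FreeAlgebra.ι ℂ Gen.K * FreeAlgebra.ι ℂ Gen.F * FreeAlgebra.ι ℂ Gen.Kinv)
      ((q ^ 2)⁻¹ • FreeAlgebra.ι ℂ Gen.F)
  | E_F : Rel l q
      (FreeAlgebra.ι ℂ Gen.E * FreeAlgebra.ι ℂ Gen.F
        - FreeAlgebra.ι ℂ Gen.F * FreeAlgebra.ι ℂ Gen.E)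
      (FreeAlgebra.ι ℂ Gen.K - FreeAlgebra.ι ℂ Gen.Kinv)
  | K_pow : Rel l q (FreeAlgebra.ι ℂ Gen.K ^ l) 1
  | E_pow : Rel l q (FreeAlgebra.ι ℂ Gen.E ^ l) 0
  | F_pow : Rel l q (FreeAlgebra.ι ℂ Gen.F ^ l) 0

/-- The quantum algebra `U_q(sl₂)`, as an associative unital `ℂ`-algebra. -/
def Uq (l : ℕ) (q : ℂ) : Type := RingQuot (Rel l q)

instance (l : ℕ) (q : ℂ) : Ring (Uq l q) := inferInstanceAs (Ring (RingQuot (Rel l q)))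

instance (l : ℕ) (q : ℂ) : Algebra ℂ (Uq l q) :=
  inferInstanceAs (Algebra ℂ (RingQuot (Rel l q)))

/-- The image of a generator in `U_q(sl₂)`. -/
def gen (l : ℕ) (q : ℂ) (g : Gen) : Uq l q :=
  RingQuot.mkAlgHom ℂ (Rel l q) (FreeAlgebra.ι ℂ g)

/-- The generator `E` of `U_q(sl₂)`. -/
def E (l : ℕ) (q : ℂ) : Uq l q := gen l q Gen.E

/-- The generator `F` of `U_q(sl₂)`. -/
def F (l : ℕ) (q : ℂ) : Uq l q := gen l q Gen.F

/-- The generator `K` of `U_q(sl₂)`. -/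
def K (l : ℕ) (q : ℂ) : Uq l q := gen l q Gen.K

/-- The inverse of `K` in `U_q(sl₂)`. -/
def Kinv (l : ℕ) (q : ℂ) : Uq l q := gen l q Gen.Kinv

/-- The quantum integer `[n] = (q^n - q^{-n}) / (q - q⁻¹)`. -/
def qint (q : ℂ) (n : ℕ) : ℂ := (q ^ n - (q ^ n)⁻¹) / (q - q⁻¹)

/-- The quantum factorial `[n]! = [n][n-1]⋯[1]`. -/
def qfact (q : ℂ) (n : ℕ) : ℂ := ∏ i ∈ Finset.Icc 1 n, qint q i

/-- The projection `π_j(K)` on the eigenspace of `K` with eigenvalue `q^{-2j}`. -/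
def weightProj (l : ℕ) (q : ℂ) (j : ℕ) : Uq l q :=
  (1 / (l : ℂ)) • ∑ i ∈ Finset.range l, q ^ (2 * i * j) • K l q ^ i

/-- `T_j = π_{j+1}(K) + ⋯ + π_{l-1-j}(K)`. -/
def T (l : ℕ) (q : ℂ) (j : ℕ) : Uq l q :=
  ∑ s ∈ Finset.Icc (j + 1) (l - 1 - j), weightProj l q s

/-- The quadratic Casimir `X = EF + (qK⁻¹ + q⁻¹K) / (q - q⁻¹)`. -/
def casimir (l : ℕ) (q : ℂ) : Uq l q :=
  E l q * F l q + (q - q⁻¹)⁻¹ • (q • Kinv l q + q⁻¹ • K l q)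

/-- The roots `b(j) = (q^{2j+1} + q^{-(2j+1)}) / (q - q⁻¹)`. -/
def b (q : ℂ) (j : ℕ) : ℂ := (q ^ (2 * j + 1) + (q ^ (2 * j + 1))⁻¹) / (q - q⁻¹)

/-- The polynomial `φ_j`, the product of `X - b(s)` over `0 ≤ s ≤ l - 1` with `b(s) ≠ b(j)`. -/
def phi (l : ℕ) (q : ℂ) (j : ℕ) : ℂ[X] :=
  ∏ s ∈ (Finset.range l).filter (fun s => b q s ≠ b q j), (X - C (b q s))

/-- The idempotent
`P_j = φ_j(X) / φ_j(b(j)) - φ_j'(b(j)) / φ_j(b(j))² (X - b(j)) φ_j(X)`. -/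
def P (l : ℕ) (q : ℂ) (j : ℕ) : Uq l q :=
  aeval (casimir l q)
    (C (1 / (phi l q j).eval (b q j)) * phi l q j
      - C ((derivative (phi l q j)).eval (b q j) / (phi l q j).eval (b q j) ^ 2)
        * ((X - C (b q j)) * phi l q j))

/-- The nilpotent `N_j = (X - b(j)) φ_j(X) / φ_j(b(j))`. -/
def N (l : ℕ) (q : ℂ) (j : ℕ) : Uq l q :=
  aeval (casimir l q)
    (C (1 / (phi l q j).eval (b q j)) * ((X - C (b q j)) * phi l q j))

/-- `N_j⁺ = T_j N_j`. -/
def Nplus (l : ℕ) (q : ℂ) (j : ℕ) : Uq l q := T l q j * N l q j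

/-- `N_j⁻ = (1 - T_j) N_j`. -/
def Nminus (l : ℕ) (q : ℂ) (j : ℕ) : Uq l q := (1 - T l q j) * N l q j

/-- The normalized Gauss sum `γ_q = l^{-1/2} ∑_{j=0}^{l-1} q^{m j²}`, where `l = 2m + 1`. -/
def gauss (l m : ℕ) (q : ℂ) : ℂ :=
  (1 / (Real.sqrt l : ℂ)) * ∑ j ∈ Finset.range l, q ^ (m * j ^ 2)

/-- `u_K = γ_q⁻¹ l^{-1/2} ∑_{i ∈ ℤ/l} q^{m i²} K^i`. -/
def uK (l m : ℕ) (q : ℂ) : Uq l q :=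
  ((gauss l m q)⁻¹ / (Real.sqrt l : ℂ)) •
    ∑ i ∈ Finset.range l, q ^ (m * i ^ 2) • K l q ^ i

/-- `u_o = ∑_{n=0}^{l-1} q^{n(n+3)/2} / [n]! K^n F^n E^n`; note that `n(n+3)` is even. -/
def uo (l : ℕ) (q : ℂ) : Uq l q :=
  ∑ n ∈ Finset.range l,
    (q ^ (n * (n + 3) / 2) / qfact q n) • (K l q ^ n * F l q ^ n * E l q ^ n)

/-- The ribbon element `v_o = K u_K u_o`. -/
def vo (l m : ℕ) (q : ℂ) : Uq l q := K l q * uK l m q * uo l q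

/-- `d_j⁺ = 2j + 1`. -/
def dplus (j : ℕ) : ℕ := 2 * j + 1

/-- `d_j⁻ = l - (2j + 1)`. -/
def dminus (l j : ℕ) : ℕ := l - (2 * j + 1)

/-- The part `q^m P_m + ∑_{j<m} q^{2j(j+1)} P_j`. -/
def voSemisimple (l m : ℕ) (q : ℂ) : Uq l q :=
  q ^ m • P l q m + ∑ j ∈ Finset.range m, q ^ (2 * j * (j + 1)) • P l q j

/-- The part `∑_{j<m} q^{2j(j+1)} (d_j⁺/[d_j⁺] N_j⁺ + d_j⁻/[d_j⁻] N_j⁻)`. -/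
def voNilpotent (l m : ℕ) (q : ℂ) : Uq l q :=
  ∑ j ∈ Finset.range m, q ^ (2 * j * (j + 1)) •
    (((dplus j : ℂ) / qint q (dplus j)) • Nplus l q j
      + ((dminus l j : ℂ) / qint q (dminus l j)) • Nminus l q j)

end

end SmallQuantum

namespace SmallQuantum

noncomputable section

/-! Everything is compared on weight spaces. The projections `proj hq s`, `s ∈ ℤ/l`, on `K =
q^{-2s}` sum to 1, so an identity may be checked after right multiplication by each of them; no
basis of the algebra is needed. There `K` is a scalar, `u_K` is a scalar by completing the square in
a Gauss sum, and `F^n E^n` is the Newton polynomial `∏_{1≤i≤n} (X - b(s-i))` in the central Casimir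
element. Hence `v_o` acts on weight `s` as a polynomial `ribbonPoly hq s` in the Casimir element
(`vo_mul_proj`).

Since `F^l = 0`, the Casimir element is killed by `∏_{t ∈ ℤ/l} (x - b(t))`. The symmetry `b(-1-t) =
b(t)` makes this `(x - b(m)) ∏_{j<m} (x - b(j))^2`, so a polynomial in it depends only on the value
at `b(m)` and the 1-jets at `b(j)`, `j < m` (`aeval_casimir_eq_zero`). `P_j` and `N_j` are the
interpolation basis for these data.

It remains to find the jets of `ribbonPoly`. By `ribbonPoly_add_one`, passing from `s` to `s+1` adds
a multiple of the full product divided by `x - b(s)`. So the values at the roots do not depend on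
`s`, while the derivative at `b(k)` can only jump at `s = k` and `s = -1-k`: this is the splitting
into `N_k^+` and `N_k^-`. Just after a jump the derivative is computed directly
(`eval_derivative_ribbonPoly`) by the finite q-identity `sum_prod_div_eq`, which gives `d/[d]` with
`d = 2k+1` or `d = l-(2k+1)`.

Centrality of `N_j^+` holds because `T_j` commutes with `E` and `F` up to two boundary terms, both
killed by `N_j` since `E^l = F^l = 0`. -/

/-- The additive character `t ↦ q ^ t` of `ℤ/l`. -/
def chi {m : ℕ} {q : ℂ} (hq : IsPrimitiveRoot q (2 * m + 1)) : AddChar (ZMod (2 * m + 1)) ℂ :=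
  AddChar.zmodChar (2 * m + 1) hq.pow_eq_one

/-! ### Characters of `ℤ/l`, Gauss sums and coincidences among the roots `b(t)`. -/

section Character

variable {m : ℕ} {q : ℂ} (hq : IsPrimitiveRoot q (2 * m + 1))

theorem q_ne_zero {m : ℕ} {q : ℂ} (hq : IsPrimitiveRoot q (2 * m + 1)) : q ≠ 0 :=
  hq.ne_zero (by omega)

theorem chi_natCast (n : ℕ) : chi hq (n : ZMod (2 * m + 1)) = q ^ n :=
  AddChar.zmodChar_apply' _ n

theorem chi_one : chi hq 1 = q := by
  simpa using chi_natCast hq 1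

theorem chi_ne_zero (t : ZMod (2 * m + 1)) : chi hq t ≠ 0 := by
  intro h
  have h1 := AddChar.map_add_eq_mul (chi hq) t (-t)
  rw [h, add_neg_cancel, AddChar.map_zero_eq_one, zero_mul] at h1
  exact one_ne_zero h1

theorem chi_neg (t : ZMod (2 * m + 1)) : chi hq (-t) = (chi hq t)⁻¹ :=
  AddChar.map_neg_eq_inv _ _

theorem chi_isPrimitive : (chi hq).IsPrimitive :=
  AddChar.zmodChar_primitive_of_primitive_root _ hq

theorem chi_eq_one_iff (t : ZMod (2 * m + 1)) : chi hq t = 1 ↔ t = 0 :=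
  ⟨fun h => by_contra fun h0 => by
    have h1 := hq.pow_eq_one_iff_dvd t.val
    rw [← chi_natCast hq, ZMod.natCast_zmod_val] at h1
    exact h0 (by simpa [ZMod.natCast_eq_zero_iff] using
      (ZMod.natCast_eq_zero_iff t.val (2 * m + 1)).2 (h1.1 h)),
   fun h => by rw [h, AddChar.map_zero_eq_one]⟩

theorem chi_injective : Function.Injective (chi hq) := by
  intro s t h
  have : chi hq (s - t) = 1 := by
    rw [sub_eq_add_neg, AddChar.map_add_eq_mul, chi_neg, h, mul_inv_cancel₀ (chi_ne_zero hq t)]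
  exact sub_eq_zero.1 ((chi_eq_one_iff hq _).1 this)

/-- In `ℤ/l` the number `m` is `-1/2`; this is what lets the exponents `m i²` be completed to
squares. -/
theorem two_mul_half : (2 : ZMod (2 * m + 1)) * m = -1 := by
  have h : ((2 * m + 1 : ℕ) : ZMod (2 * m + 1)) = 0 := ZMod.natCast_self _
  push_cast at h
  linear_combination h

theorem two_mul_eq_zero {t : ZMod (2 * m + 1)} (h : 2 * t = 0) : t = 0 := by
  linear_combination (-(m : ZMod (2 * m + 1))) * h + t * two_mul_half (m := m)

theorem sum_range_natCast {M : Type*} [AddCommMonoid M] (f : ZMod (2 * m + 1) → M) :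
    ∑ i ∈ Finset.range (2 * m + 1), f i = ∑ t, f t := by
  rw [Finset.sum_range]
  refine Fintype.sum_congr _ _ fun i => ?_
  congr 1
  exact Fin.cast_val_eq_self i

theorem prod_range_natCast {M : Type*} [CommMonoid M] (f : ZMod (2 * m + 1) → M) :
    ∏ i ∈ Finset.range (2 * m + 1), f i = ∏ t, f t := by
  rw [Finset.prod_range]
  refine Fintype.prod_congr _ _ fun i => ?_
  congr 1
  exact Fin.cast_val_eq_self i

theorem sum_chi_mul (t : ZMod (2 * m + 1)) :
    ∑ x, chi hq (x * t) = if t = 0 then ((2 * m + 1 : ℕ) : ℂ) else 0 := by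
  have := AddChar.sum_mulShift t (chi_isPrimitive hq)
  rw [ZMod.card] at this
  exact_mod_cast this

/-- The product with the conjugate sum is `l`: substituting `x = t + y` turns the phase into `m t² -
t y`, and summing over `y` leaves only `t = 0`. -/
theorem gaussSum_ne_zero : ∑ x, chi hq (m * x ^ 2) ≠ 0 := by
  have key : (∑ x, chi hq (m * x ^ 2)) * (∑ y, chi hq (-(m * y ^ 2))) = ((2 * m + 1 : ℕ) : ℂ) := by
    calc (∑ x, chi hq (m * x ^ 2)) * (∑ y, chi hq (-(m * y ^ 2)))
        = ∑ y, ∑ x, chi hq (m * x ^ 2) * chi hq (-(m * y ^ 2)) := by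
          rw [Finset.sum_mul_sum, Finset.sum_comm]
      _ = ∑ y, ∑ t, chi hq (m * t ^ 2) * chi hq (y * -t) := by
          refine Fintype.sum_congr _ _ fun y => ?_
          rw [← Equiv.sum_comp (Equiv.addRight y) fun x => chi hq (m * x ^ 2) * _]
          refine Fintype.sum_congr _ _ fun t => ?_
          rw [← AddChar.map_add_eq_mul, ← AddChar.map_add_eq_mul]
          congr 1
          simp only [Equiv.coe_addRight]
          linear_combination (t * y) * two_mul_half (m := m)
      _ = ∑ t, chi hq (m * t ^ 2) * ∑ y, chi hq (y * -t) := by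
          rw [Finset.sum_comm]
          simp_rw [Finset.mul_sum]
      _ = _ := by
          simp_rw [sum_chi_mul, neg_eq_zero]
          simp
  intro h
  rw [h, zero_mul] at key
  exact absurd key.symm (by exact_mod_cast (by omega : 2 * m + 1 ≠ 0))

/-- Completing the square by the shift `x ↦ x + 2s`, using `2m = -1`. -/
theorem sum_chi_quadratic (s : ZMod (2 * m + 1)) :
    ∑ x, chi hq (m * x ^ 2 - 2 * s * x) = chi hq (2 * s ^ 2) * ∑ x, chi hq (m * x ^ 2) := by
  rw [← Equiv.sum_comp (Equiv.addRight (2 * s)) fun x => chi hq (m * x ^ 2), Finset.mul_sum]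
  refine Fintype.sum_congr _ _ fun x => ?_
  rw [← AddChar.map_add_eq_mul]
  congr 1
  simp only [Equiv.coe_addRight]
  linear_combination (-2 * s * x - 2 * s ^ 2) * two_mul_half (m := m)

theorem chi_sub_inv_ne_zero {t : ZMod (2 * m + 1)} (ht : t ≠ 0) :
    chi hq t - chi hq (-t) ≠ 0 := by
  intro h
  have := chi_injective hq (sub_eq_zero.1 h)
  exact ht (two_mul_eq_zero (by linear_combination this))

theorem natCast_ne_zero {n : ℕ} (h0 : 0 < n) (hn : n < 2 * m + 1) :
    (n : ZMod (2 * m + 1)) ≠ 0 := by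
  rw [Ne, ZMod.natCast_eq_zero_iff]
  exact Nat.not_dvd_of_pos_of_lt h0 hn

theorem q_sub_inv_ne_zero {m : ℕ} {q : ℂ} (hq : IsPrimitiveRoot q (2 * m + 1)) (hm : 1 ≤ m) :
    q - q⁻¹ ≠ 0 := by
  have := chi_sub_inv_ne_zero hq (natCast_ne_zero (m := m) one_pos (by omega))
  rwa [chi_neg, Nat.cast_one, chi_one] at this

theorem qint_eq_chi (n : ℕ) : qint q n = (chi hq n - chi hq (-n)) / (q - q⁻¹) := by
  rw [chi_neg, chi_natCast, qint]

theorem qint_ne_zero {m : ℕ} {q : ℂ} (hq : IsPrimitiveRoot q (2 * m + 1)) (hm : 1 ≤ m) {n : ℕ}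
    (h0 : 0 < n) (hn : n < 2 * m + 1) : qint q n ≠ 0 := by
  rw [qint_eq_chi hq]
  exact div_ne_zero (chi_sub_inv_ne_zero hq (natCast_ne_zero h0 hn)) (q_sub_inv_ne_zero hq hm)

theorem qfact_succ (q : ℂ) (n : ℕ) : qfact q (n + 1) = qfact q n * qint q (n + 1) := by
  rw [qfact, Finset.prod_Icc_succ_top (by omega)]; rfl

/-- The roots `b(t)` indexed by `t ∈ ℤ/l`. -/
def beta (t : ZMod (2 * m + 1)) : ℂ :=
  (chi hq (2 * t + 1) + chi hq (-(2 * t + 1))) / (q - q⁻¹)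

theorem b_eq_beta (j : ℕ) : b q j = beta hq j := by
  have h : (2 * (j : ZMod (2 * m + 1)) + 1) = ((2 * j + 1 : ℕ) : ZMod (2 * m + 1)) := by
    push_cast; rfl
  rw [beta, h, chi_neg, chi_natCast, b]

/-- This factorization governs both the coincidences `b(s) = b(t)` and the cancellation of Newton
products against quantum factorials. -/
theorem beta_sub_beta (s t : ZMod (2 * m + 1)) :
    beta hq s - beta hq t = (chi hq (s - t) - chi hq (-(s - t))) *
      (chi hq (s + t + 1) - chi hq (-(s + t + 1))) / (q - q⁻¹) := by
  rw [beta, beta, ← sub_div]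
  congr 1
  rw [sub_mul, mul_sub, mul_sub]
  simp_rw [← AddChar.map_add_eq_mul]
  ring_nf

theorem beta_reflect (t : ZMod (2 * m + 1)) : beta hq (-1 - t) = beta hq t := by
  rw [beta, beta, add_comm]
  ring_nf

theorem beta_eq_beta_iff (hm : 1 ≤ m) (s t : ZMod (2 * m + 1)) :
    beta hq s = beta hq t ↔ s = t ∨ s = -1 - t := by
  refine ⟨fun h => ?_, ?_⟩
  · have h1 := beta_sub_beta hq s t
    rw [h, sub_self, eq_comm, div_eq_zero_iff, or_iff_left (q_sub_inv_ne_zero hq hm),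
      mul_eq_zero] at h1
    by_contra! hne
    rcases h1 with h1 | h1
    · exact chi_sub_inv_ne_zero hq (sub_ne_zero.2 hne.1) h1
    · exact chi_sub_inv_ne_zero hq (fun h0 => hne.2 (by linear_combination h0)) h1
  · rintro (rfl | rfl)
    · rfl
    · exact beta_reflect hq t

end Character

/-! ### Newton expansions of the ribbon element and their jets at one root. -/

section Interpolation

variable {m : ℕ} {q : ℂ} (hq : IsPrimitiveRoot q (2 * m + 1))

/-- The Newton polynomials `∏_{1 ≤ i ≤ n} (x - b(s - i))`. -/
def newton (s : ZMod (2 * m + 1)) (n : ℕ) : ℂ[X] :=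
  ∏ i ∈ Finset.range n, (X - C (beta hq (s - 1 - i)))

theorem newton_zero (s : ZMod (2 * m + 1)) : newton hq s 0 = 1 := rfl

theorem newton_succ (s : ZMod (2 * m + 1)) (n : ℕ) :
    newton hq s (n + 1) = newton hq s n * (X - C (beta hq (s - 1 - n))) :=
  Finset.prod_range_succ _ _

theorem newton_add_one_succ (s : ZMod (2 * m + 1)) (n : ℕ) :
    newton hq (s + 1) (n + 1) = (X - C (beta hq s)) * newton hq s n := by
  rw [newton, Finset.prod_range_succ', mul_comm, newton]
  refine congrArg₂ (· * ·) ?_ ?_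
  · simp
  · refine Finset.prod_congr rfl fun i _ => ?_
    push_cast
    ring_nf

theorem newton_full (s : ZMod (2 * m + 1)) :
    newton hq s (2 * m + 1) = ∏ t, (X - C (beta hq t)) := by
  rw [newton, prod_range_natCast (M := ℂ[X]) fun i => X - C (beta hq (s - 1 - i))]
  exact Fintype.prod_bijective _ (Equiv.subLeft (s - 1)).bijective _ _ fun i => by
    rw [Equiv.subLeft_apply]

/-- The indices `s, s-1, …, s-2m` run once through `ℤ/l`. -/
theorem mul_newton (s : ZMod (2 * m + 1)) :
    (X - C (beta hq s)) * newton hq s (2 * m) = ∏ t, (X - C (beta hq t)) := by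
  rw [← newton_add_one_succ, newton_full]

/-- The coefficients of the ribbon element on a weight space in the Newton basis. -/
def ribbonCoeff (s : ZMod (2 * m + 1)) (n : ℕ) : ℂ :=
  chi hq (2 * s ^ 2 - 2 * s + (n * (n + 3) / 2 : ℕ) - 2 * s * n) / qfact q n

/-- The polynomial in the Casimir element by which the ribbon element acts on a weight space. -/
def ribbonPoly (s : ZMod (2 * m + 1)) : ℂ[X] :=
  ∑ n ∈ Finset.range (2 * m + 1), C (ribbonCoeff hq s n) * newton hq s n

theorem half_succ (n : ℕ) : (n + 1) * (n + 1 + 3) / 2 = n * (n + 3) / 2 + (n + 2) := by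
  rw [show (n + 1) * (n + 1 + 3) = n * (n + 3) + (n + 2) * 2 by ring,
    Nat.add_mul_div_right _ _ two_pos]

theorem ribbonCoeff_succ (s : ZMod (2 * m + 1)) (n : ℕ) :
    ribbonCoeff hq s (n + 1) =
      ribbonCoeff hq s n * (chi hq (n + 2 - 2 * s) / qint q (n + 1)) := by
  rw [ribbonCoeff, ribbonCoeff, half_succ, qfact_succ, div_mul_div_comm, ← AddChar.map_add_eq_mul]
  congr 2
  push_cast
  ring

theorem ribbonCoeff_sub (s : ZMod (2 * m + 1)) (n : ℕ) :
    ribbonCoeff hq s n = ribbonCoeff hq (s + 1) n * chi hq (2 * n - 4 * s) := by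
  rw [ribbonCoeff, ribbonCoeff, div_mul_eq_mul_div, ← AddChar.map_add_eq_mul]
  congr 2
  ring

theorem ribbonCoeff_telescope (hm : 1 ≤ m) (s : ZMod (2 * m + 1)) {n : ℕ} (hn : n < 2 * m) :
    ribbonCoeff hq (s + 1) n - ribbonCoeff hq s n =
      - (ribbonCoeff hq (s + 1) (n + 1) * (beta hq (s - 1 - n) - beta hq s)) := by
  rw [ribbonCoeff_sub hq s, ribbonCoeff_succ, qint_eq_chi hq, beta_sub_beta]
  have h1 := q_sub_inv_ne_zero hq hm
  have h2 := chi_sub_inv_ne_zero hq (natCast_ne_zero (m := m) (Nat.succ_pos n) (by omega))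
  have e1 : s - 1 - n - s = -((n + 1 : ℕ) : ZMod (2 * m + 1)) := by push_cast; ring
  rw [e1, neg_neg]
  -- The exponents `n + 2 - 2(s+1)` and `s - 1 - n + s + 1` are opposite, so the ratio of the
  -- coefficients at `s` and `s+1` is the square of the factor carrying degree `n` to `n+1` at
  -- `s+1`.
  have e2 : chi hq (2 * n - 4 * s) = chi hq (n + 2 - 2 * (s + 1)) *
      chi hq (-(s - 1 - n + s + 1)) := by
    rw [← AddChar.map_add_eq_mul]; ring_nf
  have e3 : chi hq (n + 2 - 2 * (s + 1)) * chi hq (s - 1 - n + s + 1) = 1 := by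
    rw [← AddChar.map_add_eq_mul, ← AddChar.map_zero_eq_one (chi hq)]; ring_nf
  rw [e2]
  generalize q - q⁻¹ = δ at *
  field_simp
  linear_combination (-ribbonCoeff hq (s + 1) n * (chi hq ((n + 1 : ℕ) : ZMod (2 * m + 1))
    - chi hq (-((n + 1 : ℕ) : ZMod (2 * m + 1))))) * e3

/-- By `ribbonCoeff_telescope` the difference of truncated sums always collapses to its top Newton
term, and multiplying out one more factor repeats the pattern up to degree `2m`. -/
theorem ribbonPoly_add_one (hm : 1 ≤ m) (s : ZMod (2 * m + 1)) :
    ribbonPoly hq (s + 1) - ribbonPoly hq s =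
      C (ribbonCoeff hq (s + 1) (2 * m) - ribbonCoeff hq s (2 * m)) * newton hq s (2 * m) := by
  suffices h : ∀ n ≤ 2 * m, ∑ i ∈ Finset.range (n + 1), C (ribbonCoeff hq (s + 1) i) *
      newton hq (s + 1) i - ∑ i ∈ Finset.range (n + 1), C (ribbonCoeff hq s i) * newton hq s i =
      C (ribbonCoeff hq (s + 1) n - ribbonCoeff hq s n) * newton hq s n from h _ le_rfl
  intro n
  induction n with
  | zero => intro _; simp [newton_zero]
  | succ n ih =>
    intro hn
    rw [Finset.sum_range_succ, Finset.sum_range_succ _ (n + 1), add_sub_add_comm,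
      ih (by omega), newton_add_one_succ, newton_succ, ribbonCoeff_telescope hq hm s (by omega)]
    simp only [C_sub, C_neg, C_mul]
    ring

/-- Every Newton polynomial of positive degree at `s+1` contains the factor `X - b(s)`, so the
constant term is the value at `b(s)` and the cofactor evaluated there is the derivative. -/
theorem ribbonPoly_eq_add_mul (s : ZMod (2 * m + 1)) :
    ribbonPoly hq (s + 1) = C (chi hq (2 * s * (s + 1))) + (X - C (beta hq s)) *
      ∑ n ∈ Finset.range (2 * m), C (ribbonCoeff hq (s + 1) (n + 1)) * newton hq s n := by
  rw [ribbonPoly, Finset.sum_range_succ', add_comm, Finset.mul_sum]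
  congr 1
  · simp only [ribbonCoeff, newton_zero, qfact]
    simp only [Nat.cast_zero, zero_mul, Nat.zero_div]
    simp
    ring_nf
  · refine Finset.sum_congr rfl fun n _ => ?_
    rw [newton_add_one_succ]
    ring

theorem eval_ribbonPoly (s : ZMod (2 * m + 1)) :
    (ribbonPoly hq (s + 1)).eval (beta hq s) = chi hq (2 * s * (s + 1)) := by
  rw [ribbonPoly_eq_add_mul]
  simp

/-- Here `r = p⁻¹`. Raising `d` by one changes the `n`-th summand by a difference of consecutive
products, so the sum grows by a telescoping total of 1. -/
theorem sum_prod_div_eq {p r : ℂ} (hpr : p * r = 1) {L : ℕ} (hp : ∀ n < L, 1 - p ^ (n + 1) ≠ 0) :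
    ∀ d ≤ L, ∑ n ∈ Finset.range L, (∏ i ∈ Finset.range (n + 1), (1 - p ^ d * r ^ i)) /
      (1 - p ^ (n + 1)) = d := by
  intro d
  induction d with
  | zero =>
    intro _
    simp only [Nat.cast_zero]
    refine Finset.sum_eq_zero fun n _ => ?_
    rw [Finset.prod_range_succ']
    simp
  | succ d ih =>
    intro hd
    push_cast
    rw [← ih (by omega), ← sub_eq_iff_eq_add', ← Finset.sum_sub_distrib]
    have key : ∀ n < L, (∏ i ∈ Finset.range (n + 1), (1 - p ^ (d + 1) * r ^ i)) /
        (1 - p ^ (n + 1)) - (∏ i ∈ Finset.range (n + 1), (1 - p ^ d * r ^ i)) /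
        (1 - p ^ (n + 1)) = (∏ i ∈ Finset.range n, (1 - p ^ d * r ^ i)) -
        ∏ i ∈ Finset.range (n + 1), (1 - p ^ d * r ^ i) := by
      intro n hn
      have e : ∏ i ∈ Finset.range (n + 1), (1 - p ^ (d + 1) * r ^ i) =
          (∏ i ∈ Finset.range n, (1 - p ^ d * r ^ i)) * (1 - p ^ (d + 1)) := by
        rw [Finset.prod_range_succ']
        congr 1
        · refine Finset.prod_congr rfl fun i _ => ?_
          rw [pow_succ, pow_succ]
          linear_combination (-p ^ d * r ^ i) * hpr
        · simp
      have hn' : p ^ n * r ^ n = 1 := by rw [← mul_pow, hpr, one_pow]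
      rw [e, Finset.prod_range_succ, ← sub_div, div_eq_iff (hp n hn)]
      linear_combination ((∏ i ∈ Finset.range n, (1 - p ^ d * r ^ i)) * p ^ (d + 1)) * hn'
    rw [Finset.sum_congr rfl fun n hn => key n (Finset.mem_range.1 hn), Finset.sum_range_sub']
    -- The factor `i = d` is `1 - p^d r^d = 0`; this is where `d < L` is needed.
    have : ∏ i ∈ Finset.range L, (1 - p ^ d * r ^ i) = 0 :=
      Finset.prod_eq_zero (Finset.mem_range.2 (by omega : d < L)) (by
        rw [← mul_pow, hpr, one_pow, sub_self])
    rw [this]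
    simp

/-- Matches the terms of the derivative with `sum_prod_div_eq` at `p = q⁻²`. Each factor `b(t) -
b(t-1-i)` splits into a part cancelling one factor of `[n+1]!` and a part giving `1 - p^{d-i-1}`.
The factor `[d]` supplies the missing `1 - p^d`, and the uncancelled `[n+1]` the denominator. -/
theorem ribbonCoeff_mul_eval_newton (hm : 1 ≤ m) (t : ZMod (2 * m + 1)) {d : ℕ}
    (hd : (d : ZMod (2 * m + 1)) = 2 * t + 1) {n : ℕ} (hn : n < 2 * m) :
    ribbonCoeff hq (t + 1) (n + 1) * (newton hq t n).eval (beta hq t) * qint q d =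
      chi hq (2 * t * (t + 1)) *
        ((∏ i ∈ Finset.range (n + 1), (1 - chi hq (-2) ^ d * chi hq 2 ^ i)) /
          (1 - chi hq (-2) ^ (n + 1))) := by
  have hpow : ∀ (a : ZMod (2 * m + 1)) (k : ℕ), chi hq a ^ k = chi hq (k * a) := fun a k => by
    rw [← nsmul_eq_mul, AddChar.map_nsmul_eq_pow]
  have h1 := q_sub_inv_ne_zero hq hm
  have hfac : ∀ y : ZMod (2 * m + 1),
      1 - chi hq (-(2 * y)) = chi hq (-y) * (chi hq y - chi hq (-y)) := by
    intro y
    rw [mul_sub, ← AddChar.map_add_eq_mul, ← AddChar.map_add_eq_mul, neg_add_cancel,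
      AddChar.map_zero_eq_one]
    ring_nf
  have hden : ∀ k : ℕ, (1 - chi hq (-2) ^ (k + 1)) =
      chi hq (-(k + 1 : ℕ)) * (chi hq (k + 1 : ℕ) - chi hq (-(k + 1 : ℕ))) := by
    intro k
    rw [← hfac, hpow]
    ring_nf
  have hnum : ∀ i : ℕ, 1 - chi hq (-2) ^ d * chi hq 2 ^ i =
      chi hq (-(2 * t + 1 - i)) * (chi hq (2 * t + 1 - i) - chi hq (-(2 * t + 1 - i))) := by
    intro i
    rw [← hfac, hpow, hpow, ← AddChar.map_add_eq_mul, hd]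
    ring_nf
  have hne : ∀ k < 2 * m, chi hq ((k + 1 : ℕ) : ZMod (2 * m + 1)) - chi hq (-(k + 1 : ℕ)) ≠ 0 :=
    fun k hk => chi_sub_inv_ne_zero hq (natCast_ne_zero (Nat.succ_pos k) (by omega))
  simp_rw [hnum, hden]
  induction n with
  | zero =>
    have h2 := hne 0 hn
    have h3 := chi_ne_zero hq (-((0 + 1 : ℕ) : ZMod (2 * m + 1)))
    have e0 : ribbonCoeff hq (t + 1) 0 = chi hq (2 * t * (t + 1)) := by
      simp only [ribbonCoeff, qfact, Nat.cast_zero, zero_mul, Nat.zero_div]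
      simp
      ring_nf
    have e1 : chi hq (((0 : ℕ) : ZMod (2 * m + 1)) + 2 - 2 * (t + 1)) *
        chi hq (-((0 + 1 : ℕ) : ZMod (2 * m + 1))) =
        chi hq (-(2 * t + 1 - (0 : ℕ))) := by
      rw [← AddChar.map_add_eq_mul]
      push_cast
      ring_nf
    rw [ribbonCoeff_succ, e0, newton_zero, eval_one, qint_eq_chi hq, qint_eq_chi hq, hd,
      Finset.prod_range_one, ← e1]
    simp only [Nat.cast_zero, sub_zero] at e1 ⊢
    generalize q - q⁻¹ = δ at *
    field_simp
    rw [e1]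
  | succ n ih =>
    have ih := ih (by omega)
    have h2 := hne n (by omega)
    have h3 := hne (n + 1) hn
    have h4 := chi_ne_zero hq (-((n + 1 : ℕ) : ZMod (2 * m + 1)))
    have h5 := chi_ne_zero hq (-((n + 1 + 1 : ℕ) : ZMod (2 * m + 1)))
    have e1 : chi hq (((n + 1 : ℕ) : ZMod (2 * m + 1)) + 2 - 2 * (t + 1)) *
        chi hq (-((n + 1 + 1 : ℕ) : ZMod (2 * m + 1))) =
        chi hq (-(2 * t + 1 - (n + 1 : ℕ))) * chi hq (-((n + 1 : ℕ) : ZMod (2 * m + 1))) := by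
      rw [← AddChar.map_add_eq_mul, ← AddChar.map_add_eq_mul]
      push_cast
      ring_nf
    have e2 : t - (t - 1 - n) = ((n + 1 : ℕ) : ZMod (2 * m + 1)) := by push_cast; ring
    have e3 : t + (t - 1 - n) + 1 = 2 * t + 1 - ((n + 1 : ℕ) : ZMod (2 * m + 1)) := by
      push_cast; ring
    rw [ribbonCoeff_succ, newton_succ, Finset.prod_range_succ, eval_mul, eval_sub, eval_X, eval_C,
      beta_sub_beta, e2, e3, qint_eq_chi hq (n + 1 + 1)]
    generalize ribbonCoeff hq (t + 1) (n + 1) = A at *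
    generalize (newton hq t n).eval (beta hq t) = B at *
    generalize qint q d = Q at *
    generalize (∏ i ∈ Finset.range (n + 1), chi hq (-(2 * t + 1 - i)) *
      (chi hq (2 * t + 1 - i) - chi hq (-(2 * t + 1 - i)))) = R at *
    generalize chi hq (2 * t * (t + 1)) = W at *
    generalize chi hq (2 * t + 1 - (n + 1 : ℕ)) - chi hq (-(2 * t + 1 - (n + 1 : ℕ))) = Y at *
    generalize chi hq (n + 1 : ℕ) - chi hq (-(n + 1 : ℕ)) = D at *
    generalize chi hq (n + 1 + 1 : ℕ) - chi hq (-(n + 1 + 1 : ℕ)) = D' at *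
    generalize chi hq (-((n + 1 : ℕ) : ZMod (2 * m + 1))) = c at *
    generalize chi hq (-((n + 1 + 1 : ℕ) : ZMod (2 * m + 1))) = c' at *
    generalize chi hq (((n + 1 : ℕ) : ZMod (2 * m + 1)) + 2 - 2 * (t + 1)) = v at *
    generalize chi hq (-(2 * t + 1 - (n + 1 : ℕ))) = w at *
    have e4 : w = v * c' / c := by rw [e1, mul_div_cancel_right₀ _ h4]
    rw [e4]
    generalize q - q⁻¹ = δ at *
    field_simp
    field_simp at ih
    linear_combination (v * Y) * ih

theorem eval_derivative_ribbonPoly (hm : 1 ≤ m) (t : ZMod (2 * m + 1)) {d : ℕ}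
    (hd : (d : ZMod (2 * m + 1)) = 2 * t + 1) (h0 : 0 < d) (hdl : d ≤ 2 * m) :
    (derivative (ribbonPoly hq (t + 1))).eval (beta hq t) =
      chi hq (2 * t * (t + 1)) * (d / qint q d) := by
  rw [ribbonPoly_eq_add_mul]
  simp only [derivative_add, derivative_C, zero_add, derivative_mul, derivative_sub, derivative_X,
    sub_zero, one_mul, eval_add, eval_mul, eval_sub, eval_X, eval_C, sub_self, zero_mul, add_zero]
  rw [← mul_div_assoc, eq_div_iff (qint_ne_zero hq hm h0 (by omega)), eval_finsetSum,
    Finset.sum_mul]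
  have hpr : chi hq (-2) * chi hq 2 = 1 := by
    rw [← AddChar.map_add_eq_mul, neg_add_cancel, AddChar.map_zero_eq_one]
  have hp : ∀ n < 2 * m, 1 - chi hq (-2) ^ (n + 1) ≠ 0 := by
    intro n hn h
    rw [sub_eq_zero, eq_comm, ← AddChar.map_nsmul_eq_pow, chi_eq_one_iff, nsmul_eq_mul] at h
    exact natCast_ne_zero (m := m) (Nat.succ_pos n) (by omega)
      (two_mul_eq_zero (by linear_combination -h))
  rw [← sum_prod_div_eq hpr hp d hdl, Finset.mul_sum]
  refine Finset.sum_congr rfl fun n hn => ?_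
  rw [← ribbonCoeff_mul_eval_newton hq hm t hd (Finset.mem_range.1 hn), eval_mul, eval_C]

end Interpolation

/-! ### Commutation relations and centrality of the Casimir element. -/

section Relations

variable {l : ℕ} {q : ℂ}

theorem K_mul_Kinv : K l q * Kinv l q = 1 := by
  have h := RingQuot.mkAlgHom_rel ℂ (Rel.K_mul_Kinv (l := l) (q := q))
  rwa [map_mul, map_one] at h

theorem Kinv_mul_K : Kinv l q * K l q = 1 := by
  have h := RingQuot.mkAlgHom_rel ℂ (Rel.Kinv_mul_K (l := l) (q := q))
  rwa [map_mul, map_one] at h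

theorem K_mul_E : K l q * E l q = q ^ 2 • (E l q * K l q) := by
  have h := RingQuot.mkAlgHom_rel ℂ (Rel.K_E (l := l) (q := q))
  rw [map_mul, map_mul, map_smul] at h
  change K l q * E l q * Kinv l q = q ^ 2 • E l q at h
  rw [← smul_mul_assoc, ← h, mul_assoc, Kinv_mul_K, mul_one]

theorem K_mul_F : K l q * F l q = (q ^ 2)⁻¹ • (F l q * K l q) := by
  have h := RingQuot.mkAlgHom_rel ℂ (Rel.K_F (l := l) (q := q))
  rw [map_mul, map_mul, map_smul] at h
  change K l q * F l q * Kinv l q = (q ^ 2)⁻¹ • F l q at h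
  rw [← smul_mul_assoc, ← h, mul_assoc, Kinv_mul_K, mul_one]

theorem E_mul_F : E l q * F l q = F l q * E l q + (K l q - Kinv l q) := by
  have h := RingQuot.mkAlgHom_rel ℂ (Rel.E_F (l := l) (q := q))
  rw [map_sub, map_sub, map_mul, map_mul] at h
  exact sub_eq_iff_eq_add'.1 h

theorem K_pow : K l q ^ l = 1 := by
  have h := RingQuot.mkAlgHom_rel ℂ (Rel.K_pow (l := l) (q := q))
  rwa [map_pow, map_one] at h

theorem E_pow : E l q ^ l = 0 := by
  have h := RingQuot.mkAlgHom_rel ℂ (Rel.E_pow (l := l) (q := q))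
  rwa [map_pow, map_zero] at h

theorem F_pow : F l q ^ l = 0 := by
  have h := RingQuot.mkAlgHom_rel ℂ (Rel.F_pow (l := l) (q := q))
  rwa [map_pow, map_zero] at h

theorem commute_Kinv {x : Uq l q} (h : x * K l q = K l q * x) :
    x * Kinv l q = Kinv l q * x := by
  calc x * Kinv l q = Kinv l q * K l q * (x * Kinv l q) := by rw [Kinv_mul_K, one_mul]
    _ = Kinv l q * (x * K l q) * Kinv l q := by rw [h]; noncomm_ring
    _ = Kinv l q * x * (K l q * Kinv l q) := by noncomm_ring
    _ = Kinv l q * x := by rw [K_mul_Kinv, mul_one]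

theorem mem_center_of_commute {x : Uq l q} (hE : x * E l q = E l q * x)
    (hF : x * F l q = F l q * x) (hK : x * K l q = K l q * x) :
    x ∈ Subalgebra.center ℂ (Uq l q) := by
  rw [Subalgebra.mem_center_iff]
  intro y
  obtain ⟨f, hf, hgen⟩ : ∃ f : FreeAlgebra ℂ Gen →ₐ[ℂ] Uq l q, Function.Surjective f ∧
      ∀ g, f (FreeAlgebra.ι ℂ g) = gen l q g :=
    ⟨RingQuot.mkAlgHom ℂ (Rel l q), RingQuot.mkAlgHom_surjective ℂ (Rel l q), fun _ => rfl⟩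
  obtain ⟨y, rfl⟩ := hf y
  induction y using FreeAlgebra.induction with
  | grade0 r => rw [AlgHom.commutes, Algebra.commutes]
  | grade1 g =>
    rw [hgen]
    cases g with
    | E => exact hE.symm
    | F => exact hF.symm
    | K => exact hK.symm
    | Kinv => exact (commute_Kinv hK).symm
  | mul a b ha hb => rw [map_mul, mul_assoc, hb, ← mul_assoc, ha, mul_assoc]
  | add a b ha hb => rw [map_add, add_mul, ha, hb, mul_add]

theorem Kinv_mul_E (hq : q ≠ 0) : Kinv l q * E l q = (q ^ 2)⁻¹ • (E l q * Kinv l q) := by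
  have h2 : q ^ 2 ≠ 0 := pow_ne_zero 2 hq
  calc Kinv l q * E l q = (q ^ 2)⁻¹ • (Kinv l q * (q ^ 2 • (E l q * K l q)) * Kinv l q) := by
        rw [mul_smul_comm, smul_mul_assoc, inv_smul_smul₀ h2, mul_assoc, mul_assoc (E l q),
          K_mul_Kinv, mul_one]
    _ = _ := by rw [← K_mul_E, ← mul_assoc, Kinv_mul_K, one_mul]

theorem Kinv_mul_F (hq : q ≠ 0) : Kinv l q * F l q = q ^ 2 • (F l q * Kinv l q) := by
  have h2 : (q ^ 2)⁻¹ ≠ 0 := inv_ne_zero (pow_ne_zero 2 hq)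
  calc Kinv l q * F l q =
        ((q ^ 2)⁻¹)⁻¹ • (Kinv l q * ((q ^ 2)⁻¹ • (F l q * K l q)) * Kinv l q) := by
        rw [mul_smul_comm, smul_mul_assoc, inv_smul_smul₀ h2, mul_assoc, mul_assoc (F l q),
          K_mul_Kinv, mul_one]
    _ = _ := by rw [← K_mul_F, ← mul_assoc, Kinv_mul_K, one_mul, inv_inv]

/-- With both forms available, moving `E` or `F` past the Casimir element only requires commuting it
with `K` and `K⁻¹`. -/
theorem casimir_eq_FE (hq : q - q⁻¹ ≠ 0) :
    casimir l q = F l q * E l q + (q - q⁻¹)⁻¹ • (q • K l q + q⁻¹ • Kinv l q) := by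
  have e : K l q - Kinv l q = (q - q⁻¹)⁻¹ • ((q - q⁻¹) • (K l q - Kinv l q)) :=
    (inv_smul_smul₀ hq _).symm
  rw [casimir, E_mul_F, add_assoc, e, ← smul_add]
  congr 2
  module

theorem casimir_mem_center (h0 : q ≠ 0) (hq : q - q⁻¹ ≠ 0) :
    casimir l q ∈ Subalgebra.center ℂ (Uq l q) := by
  have hK : K l q * Kinv l q = Kinv l q * K l q := by rw [K_mul_Kinv, Kinv_mul_K]
  refine mem_center_of_commute ?_ ?_ ?_
  · nth_rewrite 1 [casimir]
    rw [casimir_eq_FE hq, add_mul, mul_add, mul_assoc]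
    simp only [smul_mul_assoc, mul_smul_comm, add_mul, mul_add, K_mul_E, Kinv_mul_E h0, smul_smul]
    congr 2
    rw [add_comm]
    congr 2 <;> field_simp
  · nth_rewrite 2 [casimir]
    rw [casimir_eq_FE hq, add_mul, mul_add, mul_assoc]
    simp only [smul_mul_assoc, mul_smul_comm, add_mul, mul_add, K_mul_F, Kinv_mul_F h0, smul_smul]
    congr 2
    rw [add_comm]
    congr 2 <;> field_simp
  · rw [casimir, add_mul, mul_add]
    congr 1
    · rw [mul_assoc, ← mul_assoc (K l q), K_mul_E, smul_mul_assoc, mul_assoc (E l q) (K l q),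
        K_mul_F, mul_smul_comm, smul_smul, mul_inv_cancel₀ (pow_ne_zero 2 h0), one_smul]
    · simp only [smul_mul_assoc, mul_smul_comm, add_mul, mul_add, hK]

theorem aeval_casimir_mem_center (h0 : q ≠ 0) (hq : q - q⁻¹ ≠ 0) (p : ℂ[X]) :
    aeval (casimir l q) p ∈ Subalgebra.center ℂ (Uq l q) :=
  Algebra.adjoin_le (Set.singleton_subset_iff.2 (casimir_mem_center h0 hq))
    (aeval_mem_adjoin_singleton ℂ _)

end Relations

/-! ### Weight projections and the action of `v_o` on weight spaces. -/

section Weights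

variable {m : ℕ} {q : ℂ} (hq : IsPrimitiveRoot q (2 * m + 1))

/-- The weight projections indexed by `s ∈ ℤ/l`. -/
def proj (s : ZMod (2 * m + 1)) : Uq (2 * m + 1) q :=
  (1 / ((2 * m + 1 : ℕ) : ℂ)) •
    ∑ i ∈ Finset.range (2 * m + 1), chi hq (2 * s * i) • K (2 * m + 1) q ^ i

theorem weightProj_eq_proj (s : ℕ) : weightProj (2 * m + 1) q s = proj hq s := by
  rw [weightProj, proj]
  refine congrArg _ (Finset.sum_congr rfl fun i _ => ?_)
  rw [← chi_natCast hq]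
  push_cast
  ring_nf

/-- The projection is a geometric sum in `q^{2s} K`, whose `l`-th power is 1, so multiplication by
`q^{2s} K` fixes it. -/
theorem K_mul_proj (s : ZMod (2 * m + 1)) :
    K (2 * m + 1) q * proj hq s = chi hq (-(2 * s)) • proj hq s := by
  have hpow : ∀ i : ℕ, chi hq (2 * s * i) • K (2 * m + 1) q ^ i =
      (chi hq (2 * s) • K (2 * m + 1) q) ^ i := fun i => by
    rw [_root_.smul_pow, ← AddChar.map_nsmul_eq_pow, nsmul_eq_mul, mul_comm (2 * s)]
  have h1 := mul_neg_geom_sum (chi hq (2 * s) • K (2 * m + 1) q) (2 * m + 1)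
  rw [← hpow, K_pow, ZMod.natCast_self, mul_zero, AddChar.map_zero_eq_one, one_smul, sub_self,
    sub_mul, one_mul, sub_eq_zero, smul_mul_assoc] at h1
  rw [proj, mul_smul_comm, smul_comm]
  congr 1
  simp_rw [hpow]
  rw [eq_comm, chi_neg, inv_smul_eq_iff₀ (chi_ne_zero hq _)]
  exact h1

theorem K_pow_mul_proj (s : ZMod (2 * m + 1)) (n : ℕ) :
    K (2 * m + 1) q ^ n * proj hq s = chi hq (-(2 * s * n)) • proj hq s := by
  induction n with
  | zero => simp
  | succ n ih =>
    rw [pow_succ, mul_assoc, K_mul_proj, mul_smul_comm, ih, smul_smul, ← AddChar.map_add_eq_mul]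
    push_cast
    ring_nf

theorem K_commute_proj (s : ZMod (2 * m + 1)) : Commute (K (2 * m + 1) q) (proj hq s) :=
  (Commute.sum_right _ _ _ fun i _ =>
    ((Commute.refl (K (2 * m + 1) q)).pow_right i).smul_right _).smul_right _

theorem natCast_period_ne_zero (m : ℕ) : ((2 * m + 1 : ℕ) : ℂ) ≠ 0 := Nat.cast_ne_zero.2 (by omega)

theorem sum_proj : ∑ s, proj hq s = 1 := by
  simp only [proj]
  rw [← Finset.smul_sum, Finset.sum_comm]
  simp_rw [← Finset.sum_smul]
  have h : ∀ i ∈ Finset.range (2 * m + 1),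
      (∑ s : ZMod (2 * m + 1), chi hq (2 * s * i)) • K (2 * m + 1) q ^ i =
      if i = 0 then ((2 * m + 1 : ℕ) : ℂ) • 1 else 0 := by
    intro i hi
    have e : ∀ s : ZMod (2 * m + 1), 2 * s * i = s * (2 * i) := fun s => by ring
    simp_rw [e, sum_chi_mul]
    by_cases h0 : i = 0
    · simp [h0]
    · rw [if_neg h0, if_neg, zero_smul]
      exact fun h => natCast_ne_zero (Nat.pos_of_ne_zero h0) (Finset.mem_range.1 hi)
        (two_mul_eq_zero h)
  rw [Finset.sum_congr rfl h, Finset.sum_ite_eq' , if_pos (by simp), smul_smul, one_div,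
    inv_mul_cancel₀ (natCast_period_ne_zero m), one_smul]

theorem eq_of_mul_proj_eq {x y : Uq (2 * m + 1) q} (h : ∀ s, x * proj hq s = y * proj hq s) :
    x = y := by
  rw [← mul_one x, ← mul_one y, ← sum_proj hq, Finset.mul_sum, Finset.mul_sum]
  exact Fintype.sum_congr _ _ h

theorem proj_mul_proj (s t : ZMod (2 * m + 1)) :
    proj hq s * proj hq t = if s = t then proj hq t else 0 := by
  nth_rewrite 1 [proj]
  rw [smul_mul_assoc, Finset.sum_mul]
  simp_rw [smul_mul_assoc, K_pow_mul_proj, smul_smul, ← AddChar.map_add_eq_mul]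
  rw [← Finset.sum_smul, smul_smul]
  have e : ∀ i : ℕ, 2 * s * i + -(2 * t * i) = (i : ZMod (2 * m + 1)) * (2 * (s - t)) :=
    fun i => by ring
  simp_rw [e]
  rw [sum_range_natCast fun x : ZMod (2 * m + 1) => chi hq (x * (2 * (s - t))), sum_chi_mul]
  by_cases h : s = t
  · rw [if_pos h, if_pos (by rw [h]; ring), one_div,
      inv_mul_cancel₀ (natCast_period_ne_zero m), one_smul]
  · rw [if_neg h, if_neg fun h0 => h (sub_eq_zero.1 (two_mul_eq_zero h0)), mul_zero, zero_smul]

theorem E_mul_K_pow (i : ℕ) : E (2 * m + 1) q * K (2 * m + 1) q ^ i =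
    chi hq (-(2 * i)) • (K (2 * m + 1) q ^ i * E (2 * m + 1) q) := by
  induction i with
  | zero => simp
  | succ i ih =>
    have h : E (2 * m + 1) q * K (2 * m + 1) q =
        chi hq (-2) • (K (2 * m + 1) q * E (2 * m + 1) q) := by
      have e : chi hq 2 = q ^ 2 := by rw [← chi_natCast hq, Nat.cast_ofNat]
      rw [K_mul_E, smul_smul, ← e, ← AddChar.map_add_eq_mul, neg_add_cancel,
        AddChar.map_zero_eq_one, one_smul]
    rw [pow_succ, ← mul_assoc, ih, smul_mul_assoc, mul_assoc, h, mul_smul_comm, smul_smul,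
      ← AddChar.map_add_eq_mul, mul_assoc]
    push_cast
    ring_nf

theorem F_mul_K_pow (i : ℕ) : F (2 * m + 1) q * K (2 * m + 1) q ^ i =
    chi hq (2 * i) • (K (2 * m + 1) q ^ i * F (2 * m + 1) q) := by
  induction i with
  | zero => simp
  | succ i ih =>
    have h : F (2 * m + 1) q * K (2 * m + 1) q =
        chi hq 2 • (K (2 * m + 1) q * F (2 * m + 1) q) := by
      have e : chi hq 2 = q ^ 2 := by rw [← chi_natCast hq, Nat.cast_ofNat]
      rw [K_mul_F, smul_smul, ← e, mul_inv_cancel₀ (chi_ne_zero hq _), one_smul]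
    rw [pow_succ, ← mul_assoc, ih, smul_mul_assoc, mul_assoc, h, mul_smul_comm, smul_smul,
      ← AddChar.map_add_eq_mul, mul_assoc]
    push_cast
    ring_nf

theorem E_mul_proj (s : ZMod (2 * m + 1)) :
    E (2 * m + 1) q * proj hq s = proj hq (s - 1) * E (2 * m + 1) q := by
  rw [proj, proj, mul_smul_comm, smul_mul_assoc, Finset.mul_sum, Finset.sum_mul]
  refine congrArg _ (Finset.sum_congr rfl fun i _ => ?_)
  rw [mul_smul_comm, E_mul_K_pow hq, smul_smul, ← AddChar.map_add_eq_mul, smul_mul_assoc]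
  ring_nf

theorem F_mul_proj (s : ZMod (2 * m + 1)) :
    F (2 * m + 1) q * proj hq s = proj hq (s + 1) * F (2 * m + 1) q := by
  rw [proj, proj, mul_smul_comm, smul_mul_assoc, Finset.mul_sum, Finset.sum_mul]
  refine congrArg _ (Finset.sum_congr rfl fun i _ => ?_)
  rw [mul_smul_comm, F_mul_K_pow hq, smul_smul, ← AddChar.map_add_eq_mul, smul_mul_assoc]
  ring_nf

theorem E_pow_mul_proj (s : ZMod (2 * m + 1)) (n : ℕ) :
    E (2 * m + 1) q ^ n * proj hq s = proj hq (s - n) * E (2 * m + 1) q ^ n := by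
  induction n with
  | zero => simp
  | succ n ih =>
    rw [pow_succ', mul_assoc, ih, ← mul_assoc, E_mul_proj, mul_assoc]
    push_cast
    ring_nf

theorem F_pow_mul_proj (s : ZMod (2 * m + 1)) (n : ℕ) :
    F (2 * m + 1) q ^ n * proj hq s = proj hq (s + n) * F (2 * m + 1) q ^ n := by
  induction n with
  | zero => simp
  | succ n ih =>
    rw [pow_succ', mul_assoc, ih, ← mul_assoc, F_mul_proj, mul_assoc]
    push_cast
    ring_nf

theorem Kinv_mul_proj (s : ZMod (2 * m + 1)) :
    Kinv (2 * m + 1) q * proj hq s = chi hq (2 * s) • proj hq s := by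
  have h : proj hq s = chi hq (2 * s) • (K (2 * m + 1) q * proj hq s) := by
    rw [K_mul_proj, smul_smul, ← AddChar.map_add_eq_mul, add_neg_cancel, AddChar.map_zero_eq_one,
      one_smul]
  nth_rewrite 1 [h]
  rw [mul_smul_comm, ← mul_assoc, Kinv_mul_K, one_mul]

theorem q_mul_chi (t : ZMod (2 * m + 1)) : q * chi hq t = chi hq (t + 1) := by
  rw [AddChar.map_add_eq_mul, chi_one, mul_comm]

theorem q_inv_mul_chi (t : ZMod (2 * m + 1)) : q⁻¹ * chi hq t = chi hq (t - 1) := by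
  rw [sub_eq_add_neg, AddChar.map_add_eq_mul, chi_neg, chi_one, mul_comm]

theorem EF_mul_proj (s : ZMod (2 * m + 1)) :
    E (2 * m + 1) q * F (2 * m + 1) q * proj hq s =
      aeval (casimir (2 * m + 1) q) (X - C (beta hq s)) * proj hq s := by
  have e1 : q * chi hq (2 * s) = chi hq (2 * s + 1) := by
    rw [q_mul_chi]
  have e2 : q⁻¹ * chi hq (-(2 * s)) = chi hq (-(2 * s + 1)) := by
    rw [q_inv_mul_chi]
    ring_nf
  rw [aeval_sub, aeval_X, aeval_C, casimir, sub_mul, add_mul, eq_sub_iff_add_eq,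
    Algebra.algebraMap_eq_smul_one, smul_mul_assoc, one_mul, smul_mul_assoc, add_mul,
    smul_mul_assoc, smul_mul_assoc, K_mul_proj, Kinv_mul_proj, smul_smul, smul_smul, ← add_smul,
    smul_smul, beta, e1, e2, div_eq_inv_mul]

theorem FE_mul_proj (hm : 1 ≤ m) (s : ZMod (2 * m + 1)) :
    F (2 * m + 1) q * E (2 * m + 1) q * proj hq s =
      aeval (casimir (2 * m + 1) q) (X - C (beta hq (s - 1))) * proj hq s := by
  have e1 : q * chi hq (-(2 * s)) = chi hq (-(2 * (s - 1) + 1)) := by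
    rw [q_mul_chi]
    ring_nf
  have e2 : q⁻¹ * chi hq (2 * s) = chi hq (2 * (s - 1) + 1) := by
    rw [q_inv_mul_chi]
    ring_nf
  rw [aeval_sub, aeval_X, aeval_C, casimir_eq_FE (q_sub_inv_ne_zero hq hm), sub_mul, add_mul,
    eq_sub_iff_add_eq,
    Algebra.algebraMap_eq_smul_one, smul_mul_assoc, one_mul, smul_mul_assoc, add_mul,
    smul_mul_assoc, smul_mul_assoc, K_mul_proj, Kinv_mul_proj, smul_smul, smul_smul, ← add_smul,
    smul_smul, beta, e1, e2, div_eq_inv_mul, add_comm (chi hq (-_))]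

theorem aeval_casimir_comm {m : ℕ} {q : ℂ} (hq : IsPrimitiveRoot q (2 * m + 1)) (hm : 1 ≤ m)
    (p : ℂ[X]) (x : Uq (2 * m + 1) q) :
    x * aeval (casimir (2 * m + 1) q) p = aeval (casimir (2 * m + 1) q) p * x :=
  Subalgebra.mem_center_iff.1
    (aeval_casimir_mem_center (q_ne_zero hq) (q_sub_inv_ne_zero hq hm) p) x

/-- `E^n` moves weight `s` to `s - n`, where the innermost `FE` is `X - b(s-n-1)`; being central,
this factor can be pulled out. -/
theorem F_pow_mul_E_pow_mul_proj (hm : 1 ≤ m) (s : ZMod (2 * m + 1)) (n : ℕ) :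
    F (2 * m + 1) q ^ n * E (2 * m + 1) q ^ n * proj hq s =
      aeval (casimir (2 * m + 1) q) (newton hq s n) * proj hq s := by
  induction n with
  | zero => simp [newton_zero]
  | succ n ih =>
    calc _ = F (2 * m + 1) q ^ n * (F (2 * m + 1) q * E (2 * m + 1) q *
          (E (2 * m + 1) q ^ n * proj hq s)) := by rw [pow_succ, pow_succ']; noncomm_ring
      _ = F (2 * m + 1) q ^ n * aeval (casimir (2 * m + 1) q) (X - C (beta hq (s - n - 1))) *
          (proj hq (s - n) * E (2 * m + 1) q ^ n) := by
        rw [E_pow_mul_proj, ← mul_assoc (F _ _ * E _ _), FE_mul_proj hq hm]; noncomm_ring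
      _ = aeval (casimir (2 * m + 1) q) (X - C (beta hq (s - n - 1))) *
          (F (2 * m + 1) q ^ n * E (2 * m + 1) q ^ n * proj hq s) := by
        rw [← E_pow_mul_proj, aeval_casimir_comm hq hm]; noncomm_ring
      _ = _ := by
        rw [ih, newton_succ, mul_comm (newton hq s n), map_mul, mul_assoc, sub_right_comm]

theorem E_pow_mul_F_pow_mul_proj (hm : 1 ≤ m) (s : ZMod (2 * m + 1)) (n : ℕ) :
    E (2 * m + 1) q ^ n * F (2 * m + 1) q ^ n * proj hq s =
      aeval (casimir (2 * m + 1) q) (newton hq (-s) n) * proj hq s := by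
  induction n with
  | zero => simp [newton_zero]
  | succ n ih =>
    calc _ = E (2 * m + 1) q ^ n * (E (2 * m + 1) q * F (2 * m + 1) q *
          (F (2 * m + 1) q ^ n * proj hq s)) := by rw [pow_succ, pow_succ']; noncomm_ring
      _ = E (2 * m + 1) q ^ n * aeval (casimir (2 * m + 1) q) (X - C (beta hq (s + n))) *
          (proj hq (s + n) * F (2 * m + 1) q ^ n) := by
        rw [F_pow_mul_proj, ← mul_assoc (E _ _ * F _ _), EF_mul_proj]; noncomm_ring
      _ = aeval (casimir (2 * m + 1) q) (X - C (beta hq (s + n))) *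
          (E (2 * m + 1) q ^ n * F (2 * m + 1) q ^ n * proj hq s) := by
        rw [← F_pow_mul_proj, aeval_casimir_comm hq hm]; noncomm_ring
      _ = _ := by
        have e : -s - 1 - (n : ZMod (2 * m + 1)) = -1 - (s + n) := by ring
        rw [ih, newton_succ, mul_comm (newton hq (-s) n), map_mul, mul_assoc, e, beta_reflect]

/-- Both sides are the full product with the same linear factor removed, since `b(-1-s) = b(s)`. -/
theorem newton_reflect (s : ZMod (2 * m + 1)) :
    newton hq (-1 - s) (2 * m) = newton hq s (2 * m) := by
  have h := (mul_newton hq (-1 - s)).trans (mul_newton hq s).symm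
  rw [beta_reflect] at h
  exact mul_left_cancel₀ (X_sub_C_ne_zero _) h

/-- The Newton polynomial is `F^{l-1} E^{l-1}` on this weight, so one more `F` gives `F^l = 0`.
Together with its analogue for `E`, this kills the boundary terms in the centrality of `N_j^+`. -/
theorem F_mul_newton_mul_proj (hm : 1 ≤ m) (s : ZMod (2 * m + 1)) :
    F (2 * m + 1) q * (aeval (casimir (2 * m + 1) q) (newton hq s (2 * m)) * proj hq s) = 0 := by
  rw [← F_pow_mul_E_pow_mul_proj hq hm, ← mul_assoc, ← mul_assoc, ← pow_succ', F_pow, zero_mul,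
    zero_mul]

theorem E_mul_newton_mul_proj (hm : 1 ≤ m) (s : ZMod (2 * m + 1)) :
    E (2 * m + 1) q *
      (aeval (casimir (2 * m + 1) q) (newton hq s (2 * m)) * proj hq (s + 1)) = 0 := by
  rw [← newton_reflect, show -1 - s = -(s + 1) by ring, ← E_pow_mul_F_pow_mul_proj hq hm,
    ← mul_assoc, ← mul_assoc, ← pow_succ', E_pow, zero_mul, zero_mul]

/-- On every weight the full product is `F^l E^l`. -/
theorem aeval_casimir_prod (hm : 1 ≤ m) :
    aeval (casimir (2 * m + 1) q) (∏ t, (X - C (beta hq t))) = 0 := by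
  refine eq_of_mul_proj_eq hq fun s => ?_
  rw [← newton_full hq s, ← F_pow_mul_E_pow_mul_proj hq hm, F_pow, zero_mul]

theorem uK_mul_proj (s : ZMod (2 * m + 1)) :
    uK (2 * m + 1) m q * proj hq s = chi hq (2 * s ^ 2) • proj hq s := by
  have hG : ∑ i ∈ Finset.range (2 * m + 1), q ^ (m * i ^ 2) = ∑ x, chi hq (m * x ^ 2) := by
    rw [← sum_range_natCast]
    refine Finset.sum_congr rfl fun i _ => ?_
    rw [← chi_natCast hq]
    push_cast
    rfl
  have hr : (Real.sqrt ((2 * m + 1 : ℕ) : ℝ) : ℂ) ≠ 0 := by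
    rw [Complex.ofReal_ne_zero, Real.sqrt_ne_zero']
    positivity
  rw [uK, gauss, hG, smul_mul_assoc, Finset.sum_mul]
  have h : ∀ i ∈ Finset.range (2 * m + 1), q ^ (m * i ^ 2) • K (2 * m + 1) q ^ i * proj hq s =
      chi hq (m * (i : ZMod (2 * m + 1)) ^ 2 - 2 * s * i) • proj hq s := by
    intro i _
    rw [smul_mul_assoc, K_pow_mul_proj, smul_smul, ← chi_natCast hq, ← AddChar.map_add_eq_mul]
    push_cast
    ring_nf
  rw [Finset.sum_congr rfl h, ← Finset.sum_smul,
    sum_range_natCast fun x : ZMod (2 * m + 1) => chi hq (m * x ^ 2 - 2 * s * x),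
    sum_chi_quadratic, smul_smul]
  congr 1
  have hg := gaussSum_ne_zero hq
  field_simp

theorem uo_mul_proj (hm : 1 ≤ m) (s : ZMod (2 * m + 1)) :
    uo (2 * m + 1) q * proj hq s = aeval (casimir (2 * m + 1) q)
      (∑ n ∈ Finset.range (2 * m + 1), C (chi hq ((n * (n + 3) / 2 : ℕ) - 2 * s * n) / qfact q n) *
        newton hq s n) * proj hq s := by
  rw [uo, Finset.sum_mul, map_sum, Finset.sum_mul]
  refine Finset.sum_congr rfl fun n _ => ?_
  rw [smul_mul_assoc, mul_assoc, mul_assoc, ← mul_assoc (F _ _ ^ n), F_pow_mul_E_pow_mul_proj hq hm,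
    ← mul_assoc, aeval_casimir_comm hq hm, mul_assoc, K_pow_mul_proj, mul_smul_comm, smul_smul,
    ← chi_natCast hq, div_mul_eq_mul_div, ← AddChar.map_add_eq_mul, ← sub_eq_add_neg, map_mul,
    aeval_C, Algebra.algebraMap_eq_smul_one, smul_mul_assoc, one_mul, smul_mul_assoc]

theorem vo_mul_proj (hm : 1 ≤ m) (s : ZMod (2 * m + 1)) :
    vo (2 * m + 1) m q * proj hq s =
      aeval (casimir (2 * m + 1) q) (ribbonPoly hq s) * proj hq s := by
  rw [vo, mul_assoc, uo_mul_proj hq hm, ← mul_assoc, aeval_casimir_comm hq hm, mul_assoc,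
    mul_assoc (K _ _), uK_mul_proj, mul_smul_comm, K_mul_proj, smul_smul, mul_smul_comm,
    ← smul_mul_assoc, ← map_smul, smul_eq_C_mul, Finset.mul_sum, ribbonPoly,
    ← AddChar.map_add_eq_mul]
  refine congrArg (fun p => aeval _ p * _) (Finset.sum_congr rfl fun n _ => ?_)
  rw [← mul_assoc, ← C_mul, ribbonCoeff, ← mul_div_assoc, ← AddChar.map_add_eq_mul]
  ring_nf

end Weights

/-! ### Reduction modulo the annihilating polynomial: jets at the roots `b(k)`. -/

section Jets

variable {m : ℕ} {q : ℂ}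

theorem natCast_ne_natCast {a i : ℕ} (h : a < i) (hi : i < a + (2 * m + 1)) :
    (i : ZMod (2 * m + 1)) ≠ a := by
  intro he
  refine natCast_ne_zero (m := m) (Nat.sub_pos_of_lt h) (by omega) ?_
  rw [Nat.cast_sub h.le, he, sub_self]

theorem natCast_reflect {k : ℕ} (hk : k ≤ 2 * m) :
    ((2 * m - k : ℕ) : ZMod (2 * m + 1)) = -1 - k := by
  rw [Nat.cast_sub hk]
  push_cast
  rw [two_mul_half]

theorem b_reflect (hq : IsPrimitiveRoot q (2 * m + 1)) {k : ℕ} (hk : k ≤ 2 * m) :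
    b q (2 * m - k) = b q k := by
  rw [b_eq_beta hq, b_eq_beta hq, natCast_reflect hk, beta_reflect]

theorem b_eq_b_iff (hq : IsPrimitiveRoot q (2 * m + 1)) (hm : 1 ≤ m) {s k : ℕ} (hs : s ≤ 2 * m)
    (hk : k ≤ 2 * m) : b q s = b q k ↔ s = k ∨ s = 2 * m - k := by
  rw [b_eq_beta hq, b_eq_beta hq, beta_eq_beta_iff hq hm, ← natCast_reflect hk]
  have key : ∀ a c : ℕ, a ≤ 2 * m → c ≤ 2 * m →
      ((a : ZMod (2 * m + 1)) = c ↔ a = c) := fun a c ha hc => by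
    refine ⟨fun h => ?_, fun h => by rw [h]⟩
    rcases lt_trichotomy a c with h1 | h1 | h1
    · exact absurd h.symm (natCast_ne_natCast h1 (by omega))
    · exact h1
    · exact absurd h (natCast_ne_natCast h1 (by omega))
  rw [key _ _ hs hk, key _ _ hs (by omega)]

theorem b_injOn (hq : IsPrimitiveRoot q (2 * m + 1)) (hm : 1 ≤ m) {s k : ℕ} (hs : s ≤ m)
    (hk : k ≤ m) (h : b q s = b q k) : s = k := by
  rcases (b_eq_b_iff hq hm (by omega) (by omega)).1 h with h | h <;> omega

theorem prod_beta_eq (hq : IsPrimitiveRoot q (2 * m + 1)) :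
    ∏ t, (X - C (beta hq t)) = ∏ s ∈ Finset.range (2 * m + 1), (X - C (b q s)) := by
  rw [← prod_range_natCast fun t => (X - C (beta hq t) : ℂ[X])]
  simp_rw [b_eq_beta hq]

/-- The reflection `s ↦ 2m - s` fixes only `m`, so every other factor occurs twice. -/
theorem prod_range_reflect_eq {M : Type*} [CommMonoid M] (f : ℕ → M)
    (hf : ∀ k ≤ 2 * m, f (2 * m - k) = f k) :
    ∏ s ∈ Finset.range (2 * m + 1), f s = f m * ∏ s ∈ Finset.range m, f s ^ 2 := by
  rw [show 2 * m + 1 = m + (m + 1) by ring, Finset.prod_range_add, Finset.prod_range_succ',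
    Finset.prod_pow, sq, ← Finset.prod_range_reflect (fun i => f (m + (i + 1)))]
  have h : ∏ j ∈ Finset.range m, f (m + (m - 1 - j + 1)) = ∏ j ∈ Finset.range m, f j :=
    Finset.prod_congr rfl fun j hj => by
      rw [Finset.mem_range] at hj
      rw [← hf j (by omega)]
      congr 1
      omega
  rw [h, add_zero, mul_comm _ (f m), mul_left_comm]

/-- The polynomial `f` vanishes at `b(m)` and to second order at every `b(j)` with `j < m`. -/
def JetVanish (m : ℕ) (q : ℂ) (f : ℂ[X]) : Prop :=
  (∀ k ≤ m, f.eval (b q k) = 0) ∧ ∀ k < m, (derivative f).eval (b q k) = 0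

theorem sq_dvd_of_eval_eq_zero {f : ℂ[X]} {a : ℂ} (h0 : f.eval a = 0)
    (h1 : (derivative f).eval a = 0) : (X - C a) ^ 2 ∣ f := by
  obtain ⟨g, rfl⟩ := dvd_iff_isRoot.2 h0
  have h2 : g.eval a = 0 := by simpa [derivative_mul] using h1
  rw [sq]
  exact mul_dvd_mul_left _ (dvd_iff_isRoot.2 h2)

theorem eval_derivative_of_sq_dvd {f : ℂ[X]} {a : ℂ} (h : (X - C a) ^ 2 ∣ f) :
    (derivative f).eval a = 0 := by
  obtain ⟨g, rfl⟩ := h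
  simp [derivative_mul, derivative_pow]

theorem aeval_casimir_eq_zero (hq : IsPrimitiveRoot q (2 * m + 1)) (hm : 1 ≤ m) {f : ℂ[X]}
    (hf : JetVanish m q f) : aeval (casimir (2 * m + 1) q) f = 0 := by
  have hcop : ∀ k ≤ m, ∀ j ≤ m, k ≠ j → IsCoprime (X - C (b q k)) (X - C (b q j)) :=
    fun k hk j hj h => isCoprime_X_sub_C_of_isUnit_sub
      (sub_ne_zero.2 fun hb => h (b_injOn hq hm hk hj hb)).isUnit
  have hdvd : ∏ t, (X - C (beta hq t)) ∣ f := by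
    rw [prod_beta_eq, prod_range_reflect_eq _ fun k hk => by rw [b_reflect hq hk]]
    refine IsCoprime.mul_dvd ?_ (dvd_iff_isRoot.2 (hf.1 m le_rfl)) ?_
    · refine IsCoprime.prod_right fun k hk => ?_
      rw [Finset.mem_range] at hk
      exact (hcop m le_rfl k hk.le hk.ne').pow_right
    · refine Finset.prod_dvd_of_coprime (fun k hk j hj h => ?_) fun k hk => ?_
      · rw [Finset.mem_coe, Finset.mem_range] at hk hj
        exact (hcop k hk.le j hj.le h).pow
      · rw [Finset.mem_range] at hk
        exact sq_dvd_of_eval_eq_zero (hf.1 k hk.le) (hf.2 k hk)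
  obtain ⟨g, rfl⟩ := hdvd
  rw [map_mul, aeval_casimir_prod hq hm, zero_mul]

theorem eval_phi_self (l : ℕ) (q : ℂ) (j : ℕ) : (phi l q j).eval (b q j) ≠ 0 := by
  rw [phi, eval_prod]
  refine Finset.prod_ne_zero_iff.2 fun s hs => ?_
  rw [eval_sub, eval_X, eval_C]
  exact sub_ne_zero.2 (Finset.mem_filter.1 hs).2.symm

theorem eval_phi (hq : IsPrimitiveRoot q (2 * m + 1)) (hm : 1 ≤ m) {j k : ℕ} (hj : j ≤ m)
    (hk : k ≤ m) (h : k ≠ j) : (phi (2 * m + 1) q j).eval (b q k) = 0 := by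
  rw [phi, eval_prod]
  refine Finset.prod_eq_zero (i := k) (Finset.mem_filter.2 ⟨Finset.mem_range.2 (by omega),
    fun hb => h (b_injOn hq hm hk hj hb)⟩) ?_
  rw [eval_sub, eval_X, eval_C, sub_self]

theorem eval_derivative_phi (hq : IsPrimitiveRoot q (2 * m + 1)) (hm : 1 ≤ m) {j k : ℕ}
    (hj : j ≤ m) (hk : k < m) (h : k ≠ j) :
    (derivative (phi (2 * m + 1) q j)).eval (b q k) = 0 := by
  apply eval_derivative_of_sq_dvd
  have hb : b q k ≠ b q j := fun hb => h (b_injOn hq hm hk.le hj hb)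
  have hsub : ({k, 2 * m - k} : Finset ℕ) ⊆
      (Finset.range (2 * m + 1)).filter (fun s => b q s ≠ b q j) := by
    intro s hs
    rw [Finset.mem_insert, Finset.mem_singleton] at hs
    rw [Finset.mem_filter, Finset.mem_range]
    rcases hs with rfl | rfl
    · exact ⟨by omega, hb⟩
    · exact ⟨by omega, by rwa [b_reflect hq (by omega)]⟩
  have := Finset.prod_dvd_prod_of_subset _ _ (fun s => X - C (b q s)) hsub
  rwa [Finset.prod_pair (by omega), b_reflect hq (by omega), ← sq] at this

theorem sq_mul_phi (hq : IsPrimitiveRoot q (2 * m + 1)) (hm : 1 ≤ m) {j : ℕ} (hj : j < m) :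
    (X - C (b q j)) ^ 2 * phi (2 * m + 1) q j = ∏ t, (X - C (beta hq t)) := by
  rw [prod_beta_eq, ← Finset.prod_filter_mul_prod_filter_not _ (fun s => b q s = b q j), phi]
  congr 1
  have h : (Finset.range (2 * m + 1)).filter (fun s => b q s = b q j) = {j, 2 * m - j} := by
    ext s
    rw [Finset.mem_filter, Finset.mem_range, Finset.mem_insert, Finset.mem_singleton]
    constructor
    · exact fun hs => (b_eq_b_iff hq hm (by omega) (by omega)).1 hs.2
    · exact fun hs => ⟨by omega, (b_eq_b_iff hq hm (by omega) (by omega)).2 hs⟩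
  rw [h, Finset.prod_pair (by omega), b_reflect hq (by omega), sq]

theorem newton_eq_mul_phi (hq : IsPrimitiveRoot q (2 * m + 1)) (hm : 1 ≤ m) {j : ℕ} (hj : j < m) :
    newton hq j (2 * m) = (X - C (b q j)) * phi (2 * m + 1) q j := by
  have h := (mul_newton hq j).trans (sq_mul_phi hq hm hj).symm
  rw [← b_eq_beta, sq, mul_assoc] at h
  exact mul_left_cancel₀ (X_sub_C_ne_zero _) h

/-- The polynomial defining `P_j`. -/
def PPoly (l : ℕ) (q : ℂ) (j : ℕ) : ℂ[X] :=
  C (1 / (phi l q j).eval (b q j)) * phi l q j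
    - C ((derivative (phi l q j)).eval (b q j) / (phi l q j).eval (b q j) ^ 2)
      * ((X - C (b q j)) * phi l q j)

/-- The polynomial defining `N_j`. -/
def NPoly (l : ℕ) (q : ℂ) (j : ℕ) : ℂ[X] :=
  C (1 / (phi l q j).eval (b q j)) * ((X - C (b q j)) * phi l q j)

theorem eval_PPoly (hq : IsPrimitiveRoot q (2 * m + 1)) (hm : 1 ≤ m) {j k : ℕ} (hj : j ≤ m)
    (hk : k ≤ m) : (PPoly (2 * m + 1) q j).eval (b q k) = if k = j then 1 else 0 := by
  split_ifs with h
  · subst h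
    simp [PPoly, eval_phi_self]
  · simp [PPoly, eval_phi hq hm hj hk h]

/-- The second term of `P_j` is there to cancel the derivative of the normalized `φ_j` at `b(j)`. -/
theorem eval_derivative_PPoly (hq : IsPrimitiveRoot q (2 * m + 1)) (hm : 1 ≤ m) {j k : ℕ}
    (hj : j ≤ m) (hk : k < m) : (derivative (PPoly (2 * m + 1) q j)).eval (b q k) = 0 := by
  by_cases h : k = j
  · subst h
    have := eval_phi_self (2 * m + 1) q k
    simp [PPoly, derivative_mul]
    field_simp
    ring
  · simp [PPoly, derivative_mul, eval_phi hq hm hj hk.le h, eval_derivative_phi hq hm hj hk h]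

theorem eval_NPoly (hq : IsPrimitiveRoot q (2 * m + 1)) (hm : 1 ≤ m) {j k : ℕ} (hj : j ≤ m)
    (hk : k ≤ m) : (NPoly (2 * m + 1) q j).eval (b q k) = 0 := by
  by_cases h : k = j
  · simp [NPoly, h]
  · simp [NPoly, eval_phi hq hm hj hk h]

theorem eval_derivative_NPoly (hq : IsPrimitiveRoot q (2 * m + 1)) (hm : 1 ≤ m) {j k : ℕ}
    (hj : j ≤ m) (hk : k < m) :
    (derivative (NPoly (2 * m + 1) q j)).eval (b q k) = if k = j then 1 else 0 := by
  split_ifs with h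
  · subst h
    simp [NPoly, derivative_mul, eval_phi_self]
  · simp [NPoly, derivative_mul, eval_phi hq hm hj hk.le h, eval_derivative_phi hq hm hj hk h]

/-- The polynomial in the Casimir element giving the semisimple part of the ribbon element. -/
def semisimplePoly (m : ℕ) (q : ℂ) : ℂ[X] :=
  C (q ^ m) * PPoly (2 * m + 1) q m +
    ∑ j ∈ Finset.range m, C (q ^ (2 * j * (j + 1))) * PPoly (2 * m + 1) q j

/-- The eigenvalue of the nilpotent part of the ribbon element against `N_j` in weight `i`. -/
def nilpotentCoeff (m : ℕ) (q : ℂ) (j i : ℕ) : ℂ :=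
  if i ∈ Finset.Icc (j + 1) (2 * m - j) then (dplus j : ℂ) / qint q (dplus j)
    else (dminus (2 * m + 1) j : ℂ) / qint q (dminus (2 * m + 1) j)

/-- The polynomial in the Casimir element by which the nilpotent part of the ribbon element acts
on the weight space `i`. -/
def nilpotentPoly (m : ℕ) (q : ℂ) (i : ℕ) : ℂ[X] :=
  ∑ j ∈ Finset.range m, C (q ^ (2 * j * (j + 1)) * nilpotentCoeff m q j i) *
    NPoly (2 * m + 1) q j

/-- Makes `q^m P_m` the term `j = m` of the sum of the `q^{2j(j+1)} P_j`. -/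
theorem q_pow_half (hq : IsPrimitiveRoot q (2 * m + 1)) : q ^ (2 * m * (m + 1)) = q ^ m := by
  rw [← chi_natCast hq, ← chi_natCast hq]
  congr 1
  push_cast
  linear_combination (m : ZMod (2 * m + 1)) * two_mul_half (m := m)

theorem eval_semisimplePoly (hq : IsPrimitiveRoot q (2 * m + 1)) (hm : 1 ≤ m) {k : ℕ}
    (hk : k ≤ m) : (semisimplePoly m q).eval (b q k) = q ^ (2 * k * (k + 1)) := by
  rw [semisimplePoly, ← q_pow_half hq, add_comm,
    ← Finset.sum_range_succ fun j => C (q ^ (2 * j * (j + 1))) * PPoly (2 * m + 1) q j,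
    eval_finsetSum, Finset.sum_eq_single_of_mem k (Finset.mem_range.2 (by omega))]
  · rw [eval_mul, eval_C, eval_PPoly hq hm hk hk, if_pos rfl, mul_one]
  · intro j hj h
    rw [Finset.mem_range] at hj
    rw [eval_mul, eval_PPoly hq hm (by omega) hk, if_neg h.symm, mul_zero]

theorem eval_derivative_semisimplePoly (hq : IsPrimitiveRoot q (2 * m + 1)) (hm : 1 ≤ m) {k : ℕ}
    (hk : k < m) : (derivative (semisimplePoly m q)).eval (b q k) = 0 := by
  rw [semisimplePoly, derivative_add, derivative_sum, eval_add, eval_finsetSum, derivative_C_mul,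
    eval_mul, eval_derivative_PPoly hq hm le_rfl hk, mul_zero, zero_add]
  refine Finset.sum_eq_zero fun j hj => ?_
  rw [derivative_C_mul, eval_mul, eval_derivative_PPoly hq hm (Finset.mem_range.1 hj).le hk,
    mul_zero]

theorem eval_nilpotentPoly (hq : IsPrimitiveRoot q (2 * m + 1)) (hm : 1 ≤ m) (i : ℕ) {k : ℕ}
    (hk : k ≤ m) : (nilpotentPoly m q i).eval (b q k) = 0 := by
  rw [nilpotentPoly, eval_finsetSum]
  refine Finset.sum_eq_zero fun j hj => ?_
  rw [eval_mul, eval_NPoly hq hm (Finset.mem_range.1 hj).le hk, mul_zero]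

theorem eval_derivative_nilpotentPoly (hq : IsPrimitiveRoot q (2 * m + 1)) (hm : 1 ≤ m) (i : ℕ)
    {k : ℕ} (hk : k < m) : (derivative (nilpotentPoly m q i)).eval (b q k) =
      q ^ (2 * k * (k + 1)) * nilpotentCoeff m q k i := by
  rw [nilpotentPoly, derivative_sum, eval_finsetSum,
    Finset.sum_eq_single_of_mem k (Finset.mem_range.2 hk)]
  · rw [derivative_C_mul, eval_mul, eval_C, eval_derivative_NPoly hq hm hk.le hk, if_pos rfl,
      mul_one]
  · intro j hj h
    rw [derivative_C_mul, eval_mul, eval_derivative_NPoly hq hm (Finset.mem_range.1 hj).le hk,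
      if_neg h.symm, mul_zero]

end Jets

/-! ### Values and derivatives of the ribbon polynomials at all roots. -/

section RibbonJets

variable {m : ℕ} {q : ℂ} (hq : IsPrimitiveRoot q (2 * m + 1))

theorem eval_newton_of_ne {s : ZMod (2 * m + 1)} {k : ℕ} (h : beta hq s ≠ b q k) :
    (newton hq s (2 * m)).eval (b q k) = 0 := by
  have h1 := congrArg (eval (b q k)) (mul_newton hq s)
  rw [eval_mul, eval_sub, eval_X, eval_C, eval_prod,
    Finset.prod_eq_zero (Finset.mem_univ (k : ZMod (2 * m + 1))) (by simp [b_eq_beta hq])] at h1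
  exact (mul_eq_zero.1 h1).resolve_left (sub_ne_zero.2 h.symm)

/-- The product rule for `(X - b(s))` times the Newton polynomial, which is the full product and has
a double root at `b(k)`. -/
theorem eval_derivative_newton (hm : 1 ≤ m) (s : ZMod (2 * m + 1)) {k : ℕ} (hk : k < m) :
    (newton hq s (2 * m)).eval (b q k) +
      (b q k - beta hq s) * (derivative (newton hq s (2 * m))).eval (b q k) = 0 := by
  have h1 : (derivative (∏ t, (X - C (beta hq t)))).eval (b q k) = 0 :=
    eval_derivative_of_sq_dvd ⟨_, (sq_mul_phi hq hm hk).symm⟩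
  rw [← mul_newton hq s] at h1
  simpa [derivative_mul] using h1

theorem eval_newton (hm : 1 ≤ m) (s : ZMod (2 * m + 1)) {k : ℕ} (hk : k < m) :
    (newton hq s (2 * m)).eval (b q k) = 0 := by
  by_cases h : beta hq s = b q k
  · have h1 := eval_derivative_newton hq hm s hk
    rwa [h, sub_self, zero_mul, add_zero] at h1
  · exact eval_newton_of_ne hq h

theorem eval_derivative_newton_of_ne (hm : 1 ≤ m) {s : ZMod (2 * m + 1)} {k : ℕ} (hk : k < m)
    (h : beta hq s ≠ b q k) : (derivative (newton hq s (2 * m))).eval (b q k) = 0 := by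
  have h1 := eval_derivative_newton hq hm s hk
  rw [eval_newton hq hm s hk, zero_add] at h1
  exact (mul_eq_zero.1 h1).resolve_left (sub_ne_zero.2 h.symm)

theorem eval_ribbonPoly_add_one (hm : 1 ≤ m) (s : ZMod (2 * m + 1)) {k : ℕ} (hk : k ≤ m) :
    (ribbonPoly hq (s + 1)).eval (b q k) = (ribbonPoly hq s).eval (b q k) := by
  rw [← sub_eq_zero, ← eval_sub, ribbonPoly_add_one hq hm, eval_mul, eval_C]
  rcases hk.lt_or_eq with hk | rfl
  · rw [eval_newton hq hm s hk, mul_zero]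
  · by_cases hs : s = k
    -- At the simple root `b(m)` the Newton polynomial for `s = m` need not vanish, but its
    -- coefficient does: the exponent `2·2m - 4m` relating the two top coefficients is 0.
    · have e : 2 * ((2 * k : ℕ) : ZMod (2 * k + 1)) - 4 * k = 0 := by push_cast; ring
      rw [ribbonCoeff_sub hq s, hs, e, AddChar.map_zero_eq_one, mul_one, sub_self, zero_mul]
    · rw [eval_newton_of_ne hq, mul_zero]
      rw [b_eq_beta hq, Ne, beta_eq_beta_iff hq hm, not_or]
      refine ⟨hs, fun h => hs ?_⟩
      rw [h]
      linear_combination -two_mul_half (m := k)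

/-- The value is known at weight `k + 1`, and unit steps from there reach every class of `ℤ/l`. -/
theorem eval_ribbonPoly_eq (hm : 1 ≤ m) (s : ZMod (2 * m + 1)) {k : ℕ} (hk : k ≤ m) :
    (ribbonPoly hq s).eval (b q k) = q ^ (2 * k * (k + 1)) := by
  have h : ∀ n : ℕ, (ribbonPoly hq (((k : ZMod (2 * m + 1)) + 1) + n)).eval (b q k) =
      (ribbonPoly hq ((k : ZMod (2 * m + 1)) + 1)).eval (b q k) := by
    intro n
    induction n with
    | zero => simp
    | succ n ih => rw [Nat.cast_succ, ← add_assoc, eval_ribbonPoly_add_one hq hm _ hk, ih]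
  have h1 := h (s - (k + 1)).val
  rw [ZMod.natCast_zmod_val, add_sub_cancel, b_eq_beta hq, eval_ribbonPoly] at h1
  rw [b_eq_beta hq, h1, ← chi_natCast hq]
  push_cast
  rfl

theorem eval_derivative_ribbonPoly_add_one (hm : 1 ≤ m) {s : ZMod (2 * m + 1)} {k : ℕ}
    (hk : k < m) (h : beta hq s ≠ b q k) :
    (derivative (ribbonPoly hq (s + 1))).eval (b q k) =
      (derivative (ribbonPoly hq s)).eval (b q k) := by
  rw [← sub_eq_zero, ← eval_sub, ← derivative_sub, ribbonPoly_add_one hq hm, derivative_C_mul,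
    eval_mul, eval_derivative_newton_of_ne hq hm hk h, mul_zero]

theorem beta_natCast_ne (hm : 1 ≤ m) {i k : ℕ} (hk : k < m) (h1 : (i : ZMod (2 * m + 1)) ≠ k)
    (h2 : (i : ZMod (2 * m + 1)) ≠ (2 * m - k : ℕ)) : beta hq i ≠ b q k := by
  rw [b_eq_beta hq, Ne, beta_eq_beta_iff hq hm, not_or, ← natCast_reflect (by omega)]
  exact ⟨h1, h2⟩

/-- The derivative is computed just after the jump at `k` and stays constant up to the next jump at
`2m - k`. -/
theorem eval_derivative_ribbonPoly_dplus (hm : 1 ≤ m) {k i : ℕ} (hk : k < m) (h1 : k + 1 ≤ i)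
    (h2 : i ≤ 2 * m - k) : (derivative (ribbonPoly hq i)).eval (b q k) =
      q ^ (2 * k * (k + 1)) * (dplus k / qint q (dplus k)) := by
  induction i, h1 using Nat.le_induction with
  | base =>
    have h := eval_derivative_ribbonPoly hq hm k (d := dplus k) (by rw [dplus]; push_cast; rfl)
      (by rw [dplus]; omega) (by rw [dplus]; omega)
    rw [b_eq_beta hq, ← chi_natCast hq]
    push_cast
    exact h
  | succ i hi ih =>
    rw [← ih (by omega), Nat.cast_succ]
    refine eval_derivative_ribbonPoly_add_one hq hm hk (beta_natCast_ne hq hm hk ?_ ?_)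
    · exact natCast_ne_natCast (by omega) (by omega)
    · exact (natCast_ne_natCast (by omega) (by omega)).symm

/-- The start is just after the jump at `2m - k ≡ -1 - k`, where `2t + 1 ≡ l - (2k+1)`. The range of
`i` runs past `l`, so that it covers the rest of the cycle up to the jump at `l + k ≡ k`. -/
theorem eval_derivative_ribbonPoly_dminus (hm : 1 ≤ m) {k i : ℕ} (hk : k < m)
    (h1 : 2 * m - k + 1 ≤ i) (h2 : i ≤ 2 * m + 1 + k) :
    (derivative (ribbonPoly hq i)).eval (b q k) =
      q ^ (2 * k * (k + 1)) * (dminus (2 * m + 1) k / qint q (dminus (2 * m + 1) k)) := by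
  induction i, h1 using Nat.le_induction with
  | base =>
    have hd : (dminus (2 * m + 1) k : ZMod (2 * m + 1)) =
        2 * ((2 * m - k : ℕ) : ZMod (2 * m + 1)) + 1 := by
      rw [natCast_reflect (by omega), dminus, Nat.cast_sub (by omega), ZMod.natCast_self]
      push_cast
      ring
    have h := eval_derivative_ribbonPoly hq hm _ hd (by rw [dminus]; omega)
      (by rw [dminus]; omega)
    rw [natCast_reflect (by omega), beta_reflect, ← b_eq_beta hq] at h
    rw [Nat.cast_succ, natCast_reflect (by omega), h, ← chi_natCast hq]
    push_cast
    ring_nf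
  | succ i hi ih =>
    rw [← ih (by omega), Nat.cast_succ]
    refine eval_derivative_ribbonPoly_add_one hq hm hk (beta_natCast_ne hq hm hk ?_ ?_)
    · exact natCast_ne_natCast (by omega) (by omega)
    · exact natCast_ne_natCast (by omega) (by omega)

theorem eval_derivative_ribbonPoly_eq (hm : 1 ≤ m) {k i : ℕ} (hk : k < m) (hi : i < 2 * m + 1) :
    (derivative (ribbonPoly hq i)).eval (b q k) =
      q ^ (2 * k * (k + 1)) * nilpotentCoeff m q k i := by
  rw [nilpotentCoeff]
  split_ifs with h
  · rw [Finset.mem_Icc] at h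
    exact eval_derivative_ribbonPoly_dplus hq hm hk h.1 h.2
  · rw [Finset.mem_Icc] at h
    by_cases hik : i ≤ k
    -- Weights `i ≤ k` belong to the second arc after adding one period `l`.
    · rw [← eval_derivative_ribbonPoly_dminus hq hm hk (i := i + (2 * m + 1)) (by omega)
        (by omega), Nat.cast_add, ZMod.natCast_self, add_zero]
    · exact eval_derivative_ribbonPoly_dminus hq hm hk (by omega) (by omega)

theorem jetVanish_ribbonPoly_sub (hm : 1 ≤ m) {i : ℕ} (hi : i < 2 * m + 1) :
    JetVanish m q (ribbonPoly hq i - (semisimplePoly m q + nilpotentPoly m q i)) := by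
  refine ⟨fun k hk => ?_, fun k hk => ?_⟩
  · rw [eval_sub, eval_add, eval_ribbonPoly_eq hq hm _ hk, eval_semisimplePoly hq hm hk,
      eval_nilpotentPoly hq hm _ hk, add_zero, sub_self]
  · rw [derivative_sub, derivative_add, eval_sub, eval_add,
      eval_derivative_ribbonPoly_eq hq hm hk hi, eval_derivative_semisimplePoly hq hm hk,
      eval_derivative_nilpotentPoly hq hm _ hk, zero_add, sub_self]

end RibbonJets

/-! ### The decomposition of `v_o`, semisimplicity, nilpotency and centrality. -/

section Decomposition

variable {m : ℕ} {q : ℂ} (hq : IsPrimitiveRoot q (2 * m + 1))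

theorem eq_of_mul_proj_natCast_eq {x y : Uq (2 * m + 1) q}
    (h : ∀ i < 2 * m + 1, x * proj hq (i : ℕ) = y * proj hq (i : ℕ)) : x = y := by
  refine eq_of_mul_proj_eq hq fun s => ?_
  have := h s.val (ZMod.val_lt s)
  rwa [ZMod.natCast_zmod_val] at this

theorem T_eq_sum_proj (j : ℕ) :
    T (2 * m + 1) q j = ∑ s ∈ Finset.Icc (j + 1) (2 * m - j), proj hq (s : ℕ) := by
  rw [T, Nat.add_sub_cancel]
  exact Finset.sum_congr rfl fun s _ => weightProj_eq_proj hq s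

theorem T_mul_proj (j : ℕ) {i : ℕ} (hi : i < 2 * m + 1) :
    T (2 * m + 1) q j * proj hq (i : ℕ) =
      if i ∈ Finset.Icc (j + 1) (2 * m - j) then proj hq (i : ℕ) else 0 := by
  rw [T_eq_sum_proj hq, Finset.sum_mul]
  have h : ∀ s ∈ Finset.Icc (j + 1) (2 * m - j), proj hq (s : ℕ) * proj hq (i : ℕ) =
      if s = i then proj hq (i : ℕ) else 0 := by
    intro s hs
    rw [Finset.mem_Icc] at hs
    rw [proj_mul_proj]
    by_cases he : s = i
    · rw [if_pos he, if_pos (by rw [he])]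
    · rw [if_neg he, if_neg]
      rcases lt_or_gt_of_ne he with h1 | h1
      · exact (natCast_ne_natCast h1 (by omega)).symm
      · exact natCast_ne_natCast h1 (by omega)
  rw [Finset.sum_congr rfl h, Finset.sum_ite_eq']

theorem N_eq_aeval (l : ℕ) (q : ℂ) (j : ℕ) :
    N l q j = aeval (casimir l q) (NPoly l q j) := rfl

theorem P_eq_aeval (l : ℕ) (q : ℂ) (j : ℕ) :
    P l q j = aeval (casimir l q) (PPoly l q j) := rfl

theorem voSemisimple_eq_aeval :
    voSemisimple (2 * m + 1) m q = aeval (casimir (2 * m + 1) q) (semisimplePoly m q) := by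
  rw [voSemisimple, semisimplePoly, map_add, map_sum]
  simp only [map_mul, aeval_C, Algebra.algebraMap_eq_smul_one, smul_mul_assoc, one_mul,
    P_eq_aeval]

theorem voNilpotent_mul_proj (hm : 1 ≤ m) {i : ℕ} (hi : i < 2 * m + 1) :
    voNilpotent (2 * m + 1) m q * proj hq (i : ℕ) =
      aeval (casimir (2 * m + 1) q) (nilpotentPoly m q i) * proj hq (i : ℕ) := by
  rw [voNilpotent, nilpotentPoly, map_sum, Finset.sum_mul, Finset.sum_mul]
  refine Finset.sum_congr rfl fun j _ => ?_
  rw [map_mul, aeval_C, Algebra.algebraMap_eq_smul_one, smul_mul_assoc, smul_mul_assoc,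
    smul_mul_assoc, one_mul, ← smul_smul]
  congr 1
  rw [Nplus, Nminus, N_eq_aeval, aeval_casimir_comm hq hm, aeval_casimir_comm hq hm, add_mul,
    smul_mul_assoc, smul_mul_assoc, mul_assoc, mul_assoc, sub_mul, one_mul,
    T_mul_proj hq j hi, nilpotentCoeff]
  split_ifs <;> simp

theorem vo_eq_add {m : ℕ} {q : ℂ} (hq : IsPrimitiveRoot q (2 * m + 1)) (hm : 1 ≤ m) :
    vo (2 * m + 1) m q = voSemisimple (2 * m + 1) m q + voNilpotent (2 * m + 1) m q := by
  refine eq_of_mul_proj_natCast_eq hq fun i hi => ?_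
  have h := aeval_casimir_eq_zero hq hm (jetVanish_ribbonPoly_sub hq hm hi)
  rw [map_sub, sub_eq_zero, map_add] at h
  rw [vo_mul_proj hq hm, h, add_mul, add_mul, voNilpotent_mul_proj hq hm hi,
    voSemisimple_eq_aeval]

/-- On each weight the element is a polynomial vanishing at all roots, so its square has vanishing
jets. -/
theorem voNilpotent_sq {m : ℕ} {q : ℂ} (hq : IsPrimitiveRoot q (2 * m + 1)) (hm : 1 ≤ m) :
    voNilpotent (2 * m + 1) m q ^ 2 = 0 := by
  refine eq_of_mul_proj_natCast_eq hq fun i hi => ?_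
  rw [sq, mul_assoc, voNilpotent_mul_proj hq hm hi, ← mul_assoc, aeval_casimir_comm hq hm,
    mul_assoc, voNilpotent_mul_proj hq hm hi, ← mul_assoc, ← map_mul, zero_mul,
    aeval_casimir_eq_zero hq hm, zero_mul]
  refine ⟨fun k hk => ?_, fun k hk => ?_⟩
  · rw [eval_mul, eval_nilpotentPoly hq hm _ hk, zero_mul]
  · rw [derivative_mul, eval_add, eval_mul, eval_mul, eval_nilpotentPoly hq hm _ hk.le, zero_mul,
      mul_zero, add_zero]

theorem voSemisimple_isSemisimple {m : ℕ} {q : ℂ} (hq : IsPrimitiveRoot q (2 * m + 1))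
    (hm : 1 ≤ m) :
    Module.End.IsSemisimple (LinearMap.mulLeft ℂ (voSemisimple (2 * m + 1) m q)) := by
  classical
  -- The numbers `q^{2k(k+1)}` may coincide for composite `l`; taking the set of values keeps `Q`
  -- squarefree.
  let V : Finset ℂ := (Finset.range (m + 1)).image fun k => q ^ (2 * k * (k + 1))
  let Q : ℂ[X] := ∏ v ∈ V, (X - C v)
  have hQ : Squarefree Q :=
    (separable_prod_X_sub_C_iff'.2 fun x _ y _ h => h).squarefree
  have hV : ∀ k ≤ m, Q.eval (q ^ (2 * k * (k + 1))) = 0 := fun k hk => by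
    rw [eval_prod]
    exact Finset.prod_eq_zero
      (Finset.mem_image.2 ⟨k, Finset.mem_range.2 (by omega), rfl⟩) (by simp)
  have h0 : aeval (voSemisimple (2 * m + 1) m q) Q = 0 := by
    rw [voSemisimple_eq_aeval, ← aeval_comp]
    refine aeval_casimir_eq_zero hq hm ⟨fun k hk => ?_, fun k hk => ?_⟩
    · rw [eval_comp, eval_semisimplePoly hq hm hk, hV k hk]
    -- By the chain rule, because `semisimplePoly` has zero derivative at each double root.
    · rw [derivative_comp, eval_mul, eval_derivative_semisimplePoly hq hm hk, zero_mul]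
  refine Module.End.isSemisimple_of_squarefree_aeval_eq_zero hQ ?_
  have h1 := aeval_algHom_apply (Algebra.lmul ℂ (Uq (2 * m + 1) q))
    (voSemisimple (2 * m + 1) m q) Q
  rw [h0, map_zero] at h1
  exact h1

theorem N_eq_smul_newton {j : ℕ} (hm : 1 ≤ m) (hj : j < m) :
    N (2 * m + 1) q j = (1 / (phi (2 * m + 1) q j).eval (b q j)) •
      aeval (casimir (2 * m + 1) q) (newton hq j (2 * m)) := by
  rw [newton_eq_mul_phi hq hm hj, N, map_mul, aeval_C, Algebra.algebraMap_eq_smul_one,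
    smul_mul_assoc, one_mul]

theorem newton_natCast_reflect {j : ℕ} (hj : j ≤ 2 * m) :
    newton hq ((2 * m - j : ℕ) : ZMod (2 * m + 1)) (2 * m) = newton hq j (2 * m) := by
  rw [natCast_reflect hj, newton_reflect]

theorem sum_Ico_sub_succ {M : Type*} [AddCommGroup M] (f : ℕ → M) {a c : ℕ} (h : a ≤ c) :
    ∑ i ∈ Finset.Ico a c, (f i - f (i + 1)) = f a - f c := by
  induction c, h using Nat.le_induction with
  | base => simp
  | succ c hc ih => rw [Finset.sum_Ico_succ_top hc, ih, sub_add_sub_cancel]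

/-- `E` and `F` shift weights by one, so their commutators with the interval sum `T_j` telescope to
terms at its two ends. `N_j` is proportional to the Newton polynomials at `j` and at `2m - j`, which
annihilate these terms. -/
theorem Nplus_mem_center {m : ℕ} {q : ℂ} (hq : IsPrimitiveRoot q (2 * m + 1)) (hm : 1 ≤ m)
    {j : ℕ} (hj : j < m) : Nplus (2 * m + 1) q j ∈ Subalgebra.center ℂ (Uq (2 * m + 1) q) := by
  set A := aeval (casimir (2 * m + 1) q) (newton hq j (2 * m)) with hA
  have hcomm : ∀ x : Uq (2 * m + 1) q, x * A = A * x := aeval_casimir_comm hq hm _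
  suffices h : T (2 * m + 1) q j * A ∈ Subalgebra.center ℂ (Uq (2 * m + 1) q) by
    rw [Nplus, N_eq_smul_newton hq hm hj, mul_smul_comm]
    exact Subalgebra.smul_mem _ h _
  have hIcc : Finset.Icc (j + 1) (2 * m - j) = Finset.Ico (j + 1) (2 * m - j + 1) := by
    ext s
    rw [Finset.mem_Icc, Finset.mem_Ico]
    omega
  have hj' : ((2 * m - j : ℕ) : ZMod (2 * m + 1)) + 1 = (2 * m - j + 1 : ℕ) := by push_cast; rfl
  have hE1 := E_mul_newton_mul_proj hq hm j
  have hE2 := E_mul_newton_mul_proj hq hm (2 * m - j : ℕ)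
  have hF1 := F_mul_newton_mul_proj hq hm j
  have hF2 := F_mul_newton_mul_proj hq hm (2 * m - j : ℕ)
  rw [newton_natCast_reflect hq (by omega)] at hE2 hF2
  rw [← hA, ← hcomm] at hE1 hE2 hF1 hF2
  refine mem_center_of_commute ?_ ?_ ?_
  · have h : E (2 * m + 1) q * T (2 * m + 1) q j - T (2 * m + 1) q j * E (2 * m + 1) q =
        E (2 * m + 1) q * proj hq (j + 1) - E (2 * m + 1) q * proj hq ((2 * m - j : ℕ) + 1) := by
      rw [T_eq_sum_proj hq, Finset.mul_sum, Finset.sum_mul, ← Finset.sum_sub_distrib, hIcc]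
      have h1 := sum_Ico_sub_succ (fun i : ℕ => E (2 * m + 1) q * proj hq i)
        (show j + 1 ≤ 2 * m - j + 1 by omega)
      rw [hj', ← Nat.cast_succ, ← h1]
      refine Finset.sum_congr rfl fun i _ => ?_
      rw [E_mul_proj _ ((i + 1 : ℕ) : ZMod (2 * m + 1)), Nat.cast_succ, add_sub_cancel_right]
    rw [mul_assoc, ← hcomm, ← mul_assoc, ← mul_assoc, eq_comm, ← sub_eq_zero, ← sub_mul, h,
      sub_mul, mul_assoc, mul_assoc, hE1, hE2, sub_zero]
  · have h : T (2 * m + 1) q j * F (2 * m + 1) q - F (2 * m + 1) q * T (2 * m + 1) q j =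
        F (2 * m + 1) q * proj hq j - F (2 * m + 1) q * proj hq (2 * m - j : ℕ) := by
      rw [T_eq_sum_proj hq, Finset.mul_sum, Finset.sum_mul, ← Finset.sum_sub_distrib, hIcc]
      have h1 := sum_Ico_sub_succ (fun i : ℕ => proj hq i * F (2 * m + 1) q)
        (show j + 1 ≤ 2 * m - j + 1 by omega)
      rw [F_mul_proj, F_mul_proj, hj', ← Nat.cast_succ, ← h1]
      refine Finset.sum_congr rfl fun i _ => ?_
      rw [F_mul_proj, Nat.cast_succ]
    rw [mul_assoc, ← hcomm, ← mul_assoc, ← mul_assoc, ← sub_eq_zero, ← sub_mul, h,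
      sub_mul, mul_assoc, mul_assoc, hF1, hF2, sub_zero]
  · have h : Commute (K (2 * m + 1) q) (T (2 * m + 1) q j) := by
      rw [T_eq_sum_proj hq]
      exact Commute.sum_right _ _ _ fun s _ => K_commute_proj hq s
    rw [mul_assoc, ← hcomm, ← mul_assoc, ← mul_assoc, h.eq]

theorem voSemisimple_mem_center {m : ℕ} {q : ℂ} (hq : IsPrimitiveRoot q (2 * m + 1))
    (hm : 1 ≤ m) :
    voSemisimple (2 * m + 1) m q ∈ Subalgebra.center ℂ (Uq (2 * m + 1) q) := by
  rw [voSemisimple_eq_aeval]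
  exact aeval_casimir_mem_center (q_ne_zero hq) (q_sub_inv_ne_zero hq hm) _

theorem voNilpotent_mem_center {m : ℕ} {q : ℂ} (hq : IsPrimitiveRoot q (2 * m + 1))
    (hm : 1 ≤ m) :
    voNilpotent (2 * m + 1) m q ∈ Subalgebra.center ℂ (Uq (2 * m + 1) q) := by
  refine Subalgebra.sum_mem _ fun j hj => Subalgebra.smul_mem _ (Subalgebra.add_mem _
    (Subalgebra.smul_mem _ ?_ _) (Subalgebra.smul_mem _ ?_ _)) _
  · exact Nplus_mem_center hq hm (Finset.mem_range.1 hj)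
  · rw [Nminus, sub_mul, one_mul]
    exact Subalgebra.sub_mem _
      (aeval_casimir_mem_center (q_ne_zero hq) (q_sub_inv_ne_zero hq hm) _)
      (Nplus_mem_center hq hm (Finset.mem_range.1 hj))

end Decomposition

end

end SmallQuantum

theorem mainTheorem12 (l m : ℕ) (hm : 1 ≤ m) (hl : l = 2 * m + 1)
    (q : ℂ) (hq : IsPrimitiveRoot q l) :
    SmallQuantum.vo l m q ∈ Subalgebra.center ℂ (SmallQuantum.Uq l q) ∧
    SmallQuantum.vo l m q =
      q ^ m • SmallQuantum.P l q m +
        ∑ j ∈ Finset.range m, q ^ (2 * j * (j + 1)) •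
          (SmallQuantum.P l q j
            + ((SmallQuantum.dplus j : ℂ) / SmallQuantum.qint q (SmallQuantum.dplus j)) •
                SmallQuantum.Nplus l q j
            + ((SmallQuantum.dminus l j : ℂ) / SmallQuantum.qint q (SmallQuantum.dminus l j)) •
                SmallQuantum.Nminus l q j) ∧
    -- this is the Jordan decomposition: the `P`-part acts semisimply by multiplication,
    -- the `N`-part is nilpotent, and the two parts are central
    Module.End.IsSemisimple (LinearMap.mulLeft ℂ (SmallQuantum.voSemisimple l m q)) ∧
    IsNilpotent (SmallQuantum.voNilpotent l m q) ∧
    SmallQuantum.voSemisimple l m q ∈ Subalgebra.center ℂ (SmallQuantum.Uq l q) ∧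
    SmallQuantum.voNilpotent l m q ∈ Subalgebra.center ℂ (SmallQuantum.Uq l q) := by
  subst hl
  have hS := SmallQuantum.voSemisimple_mem_center hq hm
  have hN := SmallQuantum.voNilpotent_mem_center hq hm
  refine ⟨?_, ?_, SmallQuantum.voSemisimple_isSemisimple hq hm,
    ⟨2, SmallQuantum.voNilpotent_sq hq hm⟩, hS, hN⟩
  · rw [SmallQuantum.vo_eq_add hq hm]
    exact Subalgebra.add_mem _ hS hN
  · rw [SmallQuantum.vo_eq_add hq hm, SmallQuantum.voSemisimple, SmallQuantum.voNilpotent,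
      add_assoc, ← Finset.sum_add_distrib]
    simp_rw [← smul_add, add_assoc]
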